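/- Let $\mathcal S$ be a triangulated category (with shift $\Sigma$), and let $\{\mathcal M_i,\ i\in\mathbb N\}$ be a good metric on $\mathcal S$: a sequence of full subcategories of $\mathcal S$, each containing $0$, such that for all $i$ (i) $\Sigma^{-1}\mathcal M_{i+1}\cup\mathcal M_{i+1}\cup\Sigma\mathcal M_{i+1}\subset\mathcal M_i$, and (ii) $\mathcal M_i*\mathcal M_i\subset\mathcal M_i$, that is, if $a\to b\to c\to\Sigma a$ is a distinguished triangle with $a,c\in\mathcal M_i$ then $b\in\mathcal M_i$. A sequence $E_1\to E_2\to E_3\to\cdots$ in $\mathcal S$ is *Cauchy* if for every $i$ there is an $N$ such that, for all $m'\ge m\ge N$ and every distinguished triangle $E_m\to E_{m'}\to D\to\Sigma E_m$ on the map of the sequence, $D\in\mathcal M_i$. Let $\mathrm{Mod}\text{-}\mathcal S$ be the category of additive functors $\mathcal S^{\mathrm{op}}\to\mathrm{Ab}$, with $\Sigma F=F(\Sigma^{-1}-)$, and let $Y:\mathcal S\to\mathrm{Mod}\text{-}\mathcal S$ be the Yoneda functor. Define full subcategories of $\mathrm{Mod}\text{-}\mathcal S$ as follows. * $\mathfrak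 L(\mathcal S)$ consists of the colimits $\mathrm{colim}\,Y(E_n)$ of Cauchy sequences $E_*$ in $\mathcal S$. * $\mathfrak S(\mathcal S)=\mathfrak L(\mathcal S)\cap\bigcup_{i}Y(\mathcal M_i)^\perp$, where $F\in Y(\mathcal M_i)^\perp$ means that $\mathrm{Hom}(Y(X),F)=0$ for all $X\in\mathcal M_i$. * $\mathcal L_i$ consists of the colimits $\mathrm{colim}\,Y(E_n)$ of Cauchy sequences $E_*$ in $\mathcal S$ with $E_n\in\mathcal M_i$ for all $n$. * $\mathcal N_i=\mathfrak S(\mathcal S)\cap\mathcal L_i$. Call a triangle $A\to B\to C\to\Sigma A$ in $\mathfrak S(\mathcal S)$ distinguished if it is the colimit of the image under $Y$ of a Cauchy sequence $a_*\to b_*\to c_*\to\Sigma a_*$ of distinguished triangles of $\mathcal S$ (a sequence of distinguished triangles for which $a_*$, $b_*$, $c_*$ are Cauchy). Then $\mathfrak S(\mathcal S)$, with the shift $\Sigma$ and these distinguished triangles, is a triangulated category, and $\{\mathcal N_i,\ i\in\mathbb N\}$ is a good metric on it. -/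

import Mathlib

universe v u

open CategoryTheory CategoryTheory.Limits CategoryTheory.Pretriangulated Opposite

noncomputable section

namespace MetricCompletion

/-! ### Coherence facts for shifts -/

section ShiftLemmas

variable {S : Type u} [Category.{v} S] [HasShift S ℤ]

lemma shiftFunctorAdd'_inv_app_congr {a b c c' : ℤ} (h : a + b = c) (hc : c' = c) (X : S) :
    (shiftFunctorAdd' S a b c' (by lia)).inv.app X =
      (shiftFunctorAdd' S a b c h).inv.app X ≫ eqToHom (by rw [hc]) := by
  subst hc; simp

lemma shiftFunctorAdd'_inv_app_right_zero {a z c : ℤ} (hz : z = 0) (h : c = a) (X : S) :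
    (shiftFunctorAdd' S a z c (by lia)).inv.app X =
      (shiftFunctorZero' S z hz).hom.app (X⟦a⟧) ≫ eqToHom (by rw [h]; rfl) := by
  subst hz h
  simp [shiftFunctorAdd'_add_zero_inv_app, shiftFunctorZero']

lemma shiftFunctorAdd'_inv_app_left_zero {a z c : ℤ} (hz : z = 0) (h : c = a) (X : S) :
    (shiftFunctorAdd' S z a c (by lia)).inv.app X =
      ((shiftFunctorZero' S z hz).hom.app X)⟦a⟧' ≫ eqToHom (by rw [h]; rfl) := by
  subst hz h
  simp [shiftFunctorAdd'_zero_add_inv_app, shiftFunctorZero']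

lemma shiftFunctorCompIsoId_zero_hom_app {z : ℤ} (hz : z = 0) (X : S) :
    (shiftFunctorCompIsoId S 0 z (by lia)).hom.app X =
      (shiftFunctorZero' S z hz).hom.app (X⟦(0 : ℤ)⟧) ≫ (shiftFunctorZero S ℤ).hom.app X := by
  subst hz
  simp [shiftFunctorCompIsoId, shiftFunctorZero', shiftFunctorAdd'_add_zero_inv_app]

end ShiftLemmas

/-! ### Right modules over a category, their shift, and the Yoneda functor -/

section Modules

variable (S : Type u) [Category.{v} S] [Preadditive S]

/-- The category `Mod-S` of right `S`-modules: additive functors `Sᵒᵖ ⥤ Ab`. -/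
abbrev RightMod := Sᵒᵖ ⥤+ AddCommGrpCat.{v}

/-- The Yoneda functor `Y : S ⥤ Mod-S`, `Y(X) = Hom(-, X)`. -/
def yon : S ⥤ RightMod S :=
  ObjectProperty.lift _ preadditiveYoneda (fun X => by
    rw [additiveFunctor_iff]; infer_instance)

variable [HasShift S ℤ] [∀ n : ℤ, (shiftFunctor S n).Additive]

/-- The shift by `n` on `Mod-S`: the module `F` goes to `X ↦ F(X⟦-n⟧)`. -/
def shiftMod (n : ℤ) : RightMod S ⥤ RightMod S where
  obj F := ⟨(shiftFunctor S (-n)).op ⋙ F.obj, by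
    rw [additiveFunctor_iff]; infer_instance⟩
  map f := ObjectProperty.homMk (Functor.whiskerLeft (shiftFunctor S (-n)).op f.hom)

variable {S}

lemma eqToHom_app_shiftMod {n m : ℤ} (h : n = m) (F : RightMod S) (X : Sᵒᵖ)
    (h' : (shiftMod S n).obj F = (shiftMod S m).obj F) :
    (eqToHom h').hom.app X = F.obj.map (eqToHom (by rw [h])) := by
  subst h
  simp
  rfl

/-- Additivity of the shifts on `Mod-S`, inherited from `S`. -/
def shiftModAdd (n m : ℤ) : shiftMod S (n + m) ≅ shiftMod S n ⋙ shiftMod S m :=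
  NatIso.ofComponents (fun F => ObjectProperty.isoMk _
    (Functor.isoWhiskerRight (NatIso.op
      (shiftFunctorAdd' S (-m) (-n) (-(n + m)) (by lia)).symm) F.obj))
    (fun f => by
      apply ObjectProperty.hom_ext
      apply NatTrans.ext
      funext X
      exact (f.hom.naturality _).symm)

/-- The shift by `0` on `Mod-S` is isomorphic to the identity, as on `S`. -/
def shiftModZero : shiftMod S 0 ≅ 𝟭 (RightMod S) :=
  NatIso.ofComponents (fun F => ObjectProperty.isoMk _
    (Functor.isoWhiskerRight (NatIso.op (shiftFunctorZero' S (-0) (by simp)).symm) F.obj))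
    (fun f => by
      apply ObjectProperty.hom_ext
      apply NatTrans.ext
      funext X
      exact (f.hom.naturality _).symm)

/-- The shift functors on `Mod-S` satisfy the coherence conditions of a shift by `ℤ`. -/
def shiftModCore : ShiftMkCore (RightMod S) ℤ where
  F := shiftMod S
  zero := shiftModZero
  add := shiftModAdd
  assoc_hom_app a b c F := by
    apply ObjectProperty.hom_ext
    apply NatTrans.ext
    funext X
    have H := shiftFunctorAdd'_assoc_inv_app (C := S) (-c) (-b) (-a) (-(b + c)) (-(a + b))
      (-(a + (b + c))) (by lia) (by lia) (by lia) X.unop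
    have e := eqToHom_app_shiftMod (S := S) (add_assoc a b c) F X (by rw [add_assoc])
    simp only [ObjectProperty.FullSubcategory.comp_hom, NatTrans.comp_app]
    erw [e]
    change F.obj.map _ ≫ F.obj.map _ = F.obj.map _ ≫ F.obj.map _ ≫ F.obj.map _
    simp only [← Functor.map_comp]
    congr 1
    apply Quiver.Hom.unop_inj
    simp only [unop_comp, eqToHom_unop]
    have K := shiftFunctorAdd'_inv_app_congr (S := S) (show -c + -(a + b) = -(a + (b + c)) by lia)
      (show -(a + b + c) = -(a + (b + c)) by lia) X.unop
    change (shiftFunctorAdd' S (-b) (-a) (-(a + b)) (by lia)).inv.app (X.unop⟦-c⟧) ≫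
      (shiftFunctorAdd' S (-c) (-(a + b)) (-(a + b + c)) (by lia)).inv.app X.unop =
      (((shiftFunctorAdd' S (-c) (-b) (-(b + c)) (by lia)).inv.app X.unop)⟦-a⟧' ≫
        (shiftFunctorAdd' S (-(b + c)) (-a) (-(a + (b + c))) (by lia)).inv.app X.unop) ≫
        eqToHom _
    rw [H, K, Category.assoc]
  zero_add_hom_app n F := by
    apply ObjectProperty.hom_ext
    apply NatTrans.ext
    funext X
    have e := eqToHom_app_shiftMod (S := S) (zero_add n) F X (by rw [zero_add])
    simp only [ObjectProperty.FullSubcategory.comp_hom, NatTrans.comp_app]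
    erw [e]
    change F.obj.map _ = F.obj.map _ ≫ F.obj.map _
    simp only [← Functor.map_comp]
    congr 1
    apply Quiver.Hom.unop_inj
    simp only [unop_comp, eqToHom_unop]
    exact shiftFunctorAdd'_inv_app_right_zero (S := S) (a := -n) (z := -0) (by simp) (by simp)
      X.unop
  add_zero_hom_app n F := by
    apply ObjectProperty.hom_ext
    apply NatTrans.ext
    funext X
    have e := eqToHom_app_shiftMod (S := S) (add_zero n) F X (by rw [add_zero])
    simp only [ObjectProperty.FullSubcategory.comp_hom, NatTrans.comp_app]
    erw [e]
    change F.obj.map _ = F.obj.map _ ≫ F.obj.map _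
    simp only [← Functor.map_comp]
    congr 1
    apply Quiver.Hom.unop_inj
    simp only [unop_comp, eqToHom_unop]
    exact shiftFunctorAdd'_inv_app_left_zero (S := S) (a := -n) (z := -0) (by simp) (by simp)
      X.unop

instance : HasShift (RightMod S) ℤ := hasShiftMk _ _ shiftModCore

instance (n : ℤ) : (shiftFunctor (RightMod S) n).Additive where
  map_add := rfl

/-- The isomorphism `Y(A⟦n⟧) ≅ Y(A)⟦n⟧`, which is `Hom(X, A⟦n⟧) ≃ Hom(X⟦-n⟧, A)` at each `X`. -/
def yonShiftIso (n : ℤ) :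
    shiftFunctor S n ⋙ yon S ≅ yon S ⋙ shiftFunctor (RightMod S) n :=
  NatIso.ofComponents (fun A => ObjectProperty.isoMk _
    (NatIso.ofComponents (fun X =>
      AddEquiv.toAddCommGrpIso (X := AddCommGrpCat.of (X.unop ⟶ A⟦n⟧))
        (Y := AddCommGrpCat.of (X.unop⟦-n⟧ ⟶ A))
      { toFun := fun f => f⟦-n⟧' ≫ (shiftFunctorCompIsoId S n (-n) (add_neg_cancel n)).hom.app A
        invFun := fun g => (shiftFunctorCompIsoId S (-n) n (neg_add_cancel n)).inv.app X.unop ≫ g⟦n⟧'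
        left_inv := fun f => by
          dsimp only
          rw [Functor.map_comp, shift_shiftFunctorCompIsoId_hom_app, shift_neg_shift']
          simp
        right_inv := fun g => by
          dsimp only
          rw [Functor.map_comp, shift_shiftFunctorCompIsoId_inv_app, shift_shift_neg']
          simp
        map_add' := fun f g => by
          simp [Functor.map_add, Preadditive.add_comp] })
      (fun {X Y} f => by
        ext (g : X.unop ⟶ A⟦n⟧)
        change (f.unop ≫ g)⟦-n⟧' ≫ _ = f.unop⟦-n⟧' ≫ g⟦-n⟧' ≫ _
        rw [Functor.map_comp, Category.assoc])))
    (fun {A B} f => by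
      apply ObjectProperty.hom_ext
      ext X (g : X.unop ⟶ A⟦n⟧)
      change (g ≫ f⟦n⟧')⟦-n⟧' ≫ _ = (g⟦-n⟧' ≫ _) ≫ f
      rw [Functor.map_comp, Category.assoc, Category.assoc]
      congr 1
      exact (shiftFunctorCompIsoId S n (-n) (add_neg_cancel n)).hom.naturality f)

instance : (yon S).CommShift ℤ where
  commShiftIso n := yonShiftIso n
  commShiftIso_zero := by
    ext A X (g : X.unop ⟶ A⟦(0 : ℤ)⟧)
    have h := shiftFunctorCompIsoId_zero_hom_app (S := S) (z := -0) (by simp) A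
    change g⟦-0⟧' ≫ (shiftFunctorCompIsoId S 0 (-0) (add_neg_cancel 0)).hom.app A =
      (shiftFunctorZero' S (-0) (by simp)).hom.app X.unop ≫ (g ≫ (shiftFunctorZero S ℤ).hom.app A)
    rw [h, ← Category.assoc, ← Category.assoc]
    congr 1
    exact (shiftFunctorZero' S (-0) (by simp)).hom.naturality g
  commShiftIso_add a b := by
    ext A X (g : X.unop ⟶ A⟦a + b⟧)
    rw [Functor.CommShift.isoAdd_hom_app]
    change _ = ((shiftModAdd a b).inv.app ((yon S).obj A)).hom.app X
      ((((yonShiftIso a).hom.app A).hom.app (op (X.unop⟦-b⟧)))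
       (((yonShiftIso b).hom.app (A⟦a⟧)).hom.app X (g ≫ (shiftFunctorAdd S a b).hom.app A)))
    change g⟦-(a + b)⟧' ≫ (shiftFunctorCompIsoId S (a + b) (-(a + b)) (add_neg_cancel _)).hom.app A =
      (shiftFunctorAdd' S (-b) (-a) (-(a + b)) (by lia)).hom.app X.unop ≫
      ((g ≫ (shiftFunctorAdd S a b).hom.app A)⟦-b⟧' ≫
       (shiftFunctorCompIsoId S b (-b) (add_neg_cancel b)).hom.app (A⟦a⟧))⟦-a⟧' ≫
       (shiftFunctorCompIsoId S a (-a) (add_neg_cancel a)).hom.app A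
    rw [shiftFunctorCompIsoId_add'_hom_app (X := A) (m := -b) (n := -a) (p := -(a + b))
      (m' := b) (n' := a) (p' := a + b)
      (hm := add_neg_cancel b) (hn := add_neg_cancel a) (hp := add_neg_cancel _) (h := by lia),
      shiftFunctorAdd'_eq_shiftFunctorAdd]
    have nat := (shiftFunctorAdd' S (-b) (-a) (-(a + b)) (by lia)).hom.naturality
      (g ≫ (shiftFunctorAdd S a b).hom.app A)
    rw [Functor.map_comp (shiftFunctor S (-a)), Category.assoc, ← Category.assoc,
      ← Functor.map_comp]
    exact (Category.assoc _ _ _).symm.trans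
      ((congrArg (fun x => x ≫ _) nat).trans (Category.assoc _ _ _))

/-- `F = colim Y(E)` in `Mod-S`. -/
def IsColimYon (E : ℕ ⥤ S) (F : RightMod S) : Prop :=
  ∃ c : E ⋙ yon S ⟶ (Functor.const ℕ).obj F, Nonempty (IsColimit (Cocone.mk F c))

lemma IsColimYon.shift {E : ℕ ⥤ S} {F : RightMod S} (h : IsColimYon E F) (k : ℤ) :
    IsColimYon (E ⋙ shiftFunctor S k) (F⟦k⟧) := by
  obtain ⟨c, ⟨hc⟩⟩ := h
  refine ⟨Functor.whiskerLeft E ((yon S).commShiftIso k).hom ≫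
    Functor.whiskerRight c (shiftFunctor (RightMod S) k) ≫
    { app := fun _ => 𝟙 _ }, ⟨?_⟩⟩
  have h1 := isColimitOfPreserves (shiftFunctor (RightMod S) k) hc
  refine (IsColimit.precomposeHomEquiv
    (Functor.isoWhiskerLeft E ((yon S).commShiftIso k)) _ |>.symm h1).ofIsoColimit ?_
  refine Cocone.ext (Iso.refl _) ?_
  intro j
  simp

end Modules

/-! ### Good metrics and completions -/

section Metric

variable {S : Type u} [Category.{v} S] [Preadditive S] [HasZeroObject S] [HasShift S ℤ]
  [∀ n : ℤ, (shiftFunctor S n).Additive] [Pretriangulated S]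

/-- A good metric on a triangulated category `S`: a sequence `M 0, M 1, …` of full subcategories
of `S` containing `0`, such that `M (i + 1)` and its shifts by `±1` are contained in `M i`, and
such that `M i * M i ⊆ M i`. -/
class IsGoodMetric (M : ℕ → ObjectProperty S) : Prop where
  zero_mem (i : ℕ) : ∃ Z : S, IsZero Z ∧ M i Z
  shift_neg_one (i : ℕ) (X : S) : M (i + 1) X → M i (X⟦(-1 : ℤ)⟧)
  le_prev (i : ℕ) (X : S) : M (i + 1) X → M i X
  shift_one (i : ℕ) (X : S) : M (i + 1) X → M i (X⟦(1 : ℤ)⟧)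
  ext (i : ℕ) (T : Triangle S) (hT : T ∈ distTriang S) : M i T.obj₁ → M i T.obj₃ → M i T.obj₂

variable (M : ℕ → ObjectProperty S)

/-- A sequence `E 0 ⟶ E 1 ⟶ ⋯` in `S` is Cauchy with respect to `M` if for every `i` there is an
`N` such that for all `N ≤ m ≤ m'`, in any distinguished triangle `E m ⟶ E m' ⟶ D ⟶ (E m)⟦1⟧` on
the map of the sequence, the object `D` lies in `M i`. -/
def IsCauchy (E : ℕ ⥤ S) : Prop :=
  ∀ i : ℕ, ∃ N : ℕ, ∀ (m m' : ℕ) (h : m ≤ m'), N ≤ m →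
    ∀ (D : S) (g : E.obj m' ⟶ D) (w : D ⟶ (E.obj m)⟦(1 : ℤ)⟧),
      Triangle.mk (E.map (homOfLE h)) g w ∈ distTriang S → M i D

/-- `𝔏(S)`: the colimits in `Mod-S` of Cauchy sequences in `S`. -/
def preCompletion : ObjectProperty (RightMod S) :=
  fun F => ∃ E : ℕ ⥤ S, IsCauchy M E ∧ IsColimYon E F

/-- `⋃ i, Y(M i)^⊥`: the modules `F` such that, for some `i`, every morphism `Y(X) ⟶ F` with
`X` in `M i` vanishes. -/
def compactlySupported : ObjectProperty (RightMod S) :=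
  fun F => ∃ i : ℕ, ∀ (X : S), M i X → ∀ f : (yon S).obj X ⟶ F, f = 0

/-- `𝔖(S) = 𝔏(S) ∩ ⋃ i, Y(M i)^⊥`, as a property of right modules. -/
def completion : ObjectProperty (RightMod S) :=
  fun F => preCompletion M F ∧ compactlySupported M F

/-- `L i ⊆ 𝔏(S)`: the colimits in `Mod-S` of Cauchy sequences in `S` all of whose terms lie
in `M i`. -/
def preBall (i : ℕ) : ObjectProperty (RightMod S) :=
  fun F => ∃ E : ℕ ⥤ S, IsCauchy M E ∧ (∀ n, M i (E.obj n)) ∧ IsColimYon E F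

/-- The full subcategory `𝔖(S)` of `Mod-S`. -/
abbrev Completion := (completion M).FullSubcategory

/-- `N i = 𝔖(S) ∩ L i`, as a full subcategory of `𝔖(S)`. -/
def ball (i : ℕ) : ObjectProperty (Completion M) :=
  fun F => preBall M i F.obj

/-- A triangle in `Mod-S` is strong if it is the colimit of the image under `Y` of a Cauchy
sequence of distinguished triangles of `S`. -/
def IsStrongTriangle (T : Triangle (RightMod S)) : Prop :=
  ∃ t : ℕ ⥤ Triangle S, (∀ n, t.obj n ∈ distTriang S) ∧
    IsCauchy M (t ⋙ Triangle.π₁) ∧ IsCauchy M (t ⋙ Triangle.π₂) ∧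
    IsCauchy M (t ⋙ Triangle.π₃) ∧
    ∃ c : t ⋙ (yon S).mapTriangle ⟶ (Functor.const ℕ).obj T,
      Nonempty (IsColimit (Triangle.π₁.mapCocone (Cocone.mk T c))) ∧
      Nonempty (IsColimit (Triangle.π₂.mapCocone (Cocone.mk T c))) ∧
      Nonempty (IsColimit (Triangle.π₃.mapCocone (Cocone.mk T c)))

/-! ### The zero object and the shift of `𝔖(S)` -/

variable {M}

lemma IsGoodMetric.of_iso [IsGoodMetric M] {i : ℕ} {X Y : S} (e : X ≅ Y) (hX : M i X) :
    M i Y := by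
  obtain ⟨Z, hZ, hMZ⟩ := IsGoodMetric.zero_mem (M := M) i
  refine IsGoodMetric.ext (M := M) i (Triangle.mk e.hom (0 : Y ⟶ Z) 0) ?_ hX hMZ
  exact isomorphic_distinguished _ (contractible_distinguished X) _
    (Triangle.isoMk _ _ (Iso.refl _) e.symm (hZ.iso (isZero_zero S))
      ((e.hom_inv_id).trans (Category.id_comp _).symm) (zero_comp.trans comp_zero.symm)
      (zero_comp.trans comp_zero.symm))

lemma IsGoodMetric.of_isZero [IsGoodMetric M] {i : ℕ} {X : S} (hX : IsZero X) : M i X := by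
  obtain ⟨Z, hZ, hMZ⟩ := IsGoodMetric.zero_mem (M := M) i
  exact IsGoodMetric.of_iso (hZ.iso hX) hMZ

lemma IsGoodMetric.shift_nat [IsGoodMetric M] (n : ℕ) (i : ℕ) (X : S) (hX : M (i + n) X) :
    M i (X⟦(n : ℤ)⟧) ∧ M i (X⟦(-n : ℤ)⟧) := by
  induction n generalizing X with
  | zero =>
    exact ⟨of_iso ((shiftFunctorZero' S ((0 : ℕ) : ℤ) (by simp)).symm.app X) hX,
      of_iso ((shiftFunctorZero' S (-((0 : ℕ) : ℤ)) (by simp)).symm.app X) hX⟩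
  | succ n ih =>
    exact ⟨of_iso ((shiftFunctorAdd' S 1 (n : ℤ) ((n + 1 : ℕ) : ℤ) (by lia)).symm.app X)
        (ih _ (IsGoodMetric.shift_one _ _ hX)).1,
      of_iso ((shiftFunctorAdd' S (-1) (-n : ℤ) (-((n + 1 : ℕ) : ℤ)) (by lia)).symm.app X)
        (ih _ (IsGoodMetric.shift_neg_one _ _ hX)).2⟩

lemma IsGoodMetric.shift_int [IsGoodMetric M] (k : ℤ) (i : ℕ) (X : S)
    (hX : M (i + k.natAbs) X) : M i (X⟦k⟧) := by
  have h := IsGoodMetric.shift_nat k.natAbs i X hX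
  rcases Int.natAbs_eq k with hk | hk
  · rw [hk]; exact h.1
  · rw [hk]; exact h.2

lemma IsCauchy.shift [IsGoodMetric M] {E : ℕ ⥤ S} (hE : IsCauchy M E) (k : ℤ) :
    IsCauchy M (E ⋙ shiftFunctor S k) := by
  intro i
  obtain ⟨N, hN⟩ := hE (i + k.natAbs)
  refine ⟨N, fun m m' h hm D g w hT => ?_⟩
  obtain ⟨D', g', w', hT'⟩ := distinguished_cocone_triangle (E.map (homOfLE h))
  have hD' := IsGoodMetric.shift_int k i D' (hN m m' h hm D' g' w' hT')
  have hT'' := Triangle.shift_distinguished _ hT' k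
  have comm : (Triangle.mk ((E ⋙ shiftFunctor S k).map (homOfLE h)) g w).mor₁ ≫
      𝟙 ((E.obj m')⟦k⟧) = (k.negOnePow • 𝟙 ((E.obj m)⟦k⟧)) ≫
        ((shiftFunctor (Triangle S) k).obj (Triangle.mk (E.map (homOfLE h)) g' w')).mor₁ := by
    change (E.map (homOfLE h))⟦k⟧' ≫ 𝟙 _ =
      (k.negOnePow • 𝟙 ((E.obj m)⟦k⟧)) ≫ (k.negOnePow • (E.map (homOfLE h))⟦k⟧')
    simp [smul_smul]
  have hu : (k.negOnePow • 𝟙 ((E.obj m)⟦k⟧)) ≫ (k.negOnePow • 𝟙 ((E.obj m)⟦k⟧)) =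
      𝟙 ((E.obj m)⟦k⟧) := by simp [smul_smul]
  exact IsGoodMetric.of_iso
    (Triangle.π₃.mapIso (isoTriangleOfIso₁₂ _ _ hT hT''
      { hom := k.negOnePow • 𝟙 ((E.obj m)⟦k⟧)
        inv := k.negOnePow • 𝟙 ((E.obj m)⟦k⟧)
        hom_inv_id := hu
        inv_hom_id := hu } (Iso.refl _) comm)).symm hD'

instance [IsGoodMetric M] : (completion M).IsStableUnderShift ℤ where
  isStableUnderShiftBy k :=
   { le_shift := by
      rintro F ⟨⟨E, hE, hF⟩, ⟨i, hi⟩⟩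
      refine ⟨⟨_, hE.shift k, hF.shift k⟩, ⟨i + k.natAbs, fun X hX f => ?_⟩⟩
      have hX' : M i (X⟦-k⟧) := IsGoodMetric.shift_int _ _ _ (by simpa using hX)
      have h0 := hi _ hX' (((yon S).commShiftIso (-k)).hom.app X ≫ f⟦-k⟧' ≫
        (shiftFunctorCompIsoId (RightMod S) k (-k) (add_neg_cancel k)).hom.app F)
      apply (shiftFunctor (RightMod S) (-k)).map_injective
      rw [Functor.map_zero, ← cancel_mono ((shiftFunctorCompIsoId (RightMod S) k (-k)
        (add_neg_cancel k)).hom.app F), ← cancel_epi (((yon S).commShiftIso (-k)).hom.app X),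
        h0, zero_comp, comp_zero] }

instance [IsGoodMetric M] : (completion M).ContainsZero where
  exists_zero := by
    obtain ⟨Z, hZ, -⟩ := IsGoodMetric.zero_mem (M := M) 0
    have hz : IsZero ((yon S).obj Z) := by
      rw [IsZero.iff_id_eq_zero]
      ext X (f : X.unop ⟶ Z)
      exact hZ.eq_of_tgt _ _
    refine ⟨(yon S).obj Z, hz, ⟨(Functor.const ℕ).obj Z, ?_, ?_⟩, ⟨0, fun X _ f => hz.eq_of_tgt _ _⟩⟩
    · intro i
      refine ⟨0, fun m m' h _ D g w hT => IsGoodMetric.of_isZero ?_⟩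
      exact Triangle.isZero₃_of_isZero₁₂ _ hT hZ hZ
    · refine ⟨{ app := fun _ => 𝟙 _ }, ⟨?_⟩⟩
      exact
        { desc := fun s => 0
          fac := fun s j => hz.eq_of_src _ _
          uniq := fun s m _ => hz.eq_of_src _ _ }


variable (M) in
/-- The distinguished triangles of `𝔖(S)`: the strong triangles whose three objects lie
in `𝔖(S)`. -/
def completionDistTriang [IsGoodMetric M] : Set (Triangle (Completion M)) :=
  {T | IsStrongTriangle M ((completion M).ι.mapTriangle.obj T)}

end Metric

end MetricCompletion

end

/-!
The distinguished triangles of `𝔖(S)` are colimits of sequences of distinguished triangles of `S`.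
A morphism between colimits of sequences lifts to the sequences (`exists_sequence_lift`), and a
morphism of Cauchy sequences has a Cauchy sequence of cones, because Verdier's `3 × 3` lemma makes
the cone of the transition map an extension of the cones of the given ones
(`exists_completion_with_cones`, `exists_cone_sequence`). This gives a strong triangle on every
morphism of `𝔖(S)`. The other axioms ask for morphisms and triangles in `𝔖(S)` whose counterparts in
`S` exist at each index of the sequences but are not compatible as the index varies, so one cannot
pass to the colimit.

The way out is that a single large index is enough. If `F = colim Y(E n)` with `E` Cauchy, and `G`
is a homological right module orthogonal to `M i`, then `Hom(F, G) ≅ Hom(Y(E n), G)` for all large `n`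
(`IsCauchy.exists_bijective_comp`): the cones of the transition maps and their negative shifts
eventually lie in `M i`, where `G` vanishes. Every object of `𝔖(S)` is such a `G` for some `i`.
Hence the terms of large index of a strong triangle *approximate* it (`IsApproximation`), as far as
morphisms to finitely many given objects of `𝔖(S)` are concerned:

* a commutative square between strong triangles lifts to `S` at one index, is completed there to
  a morphism of triangles, and the third component extends to `𝔖(S)`
  (`IsApproximation.exists_hom`);
* `Hom(-, G)` is exact on an approximated triangle, so by the five lemma an approximated triangle is
  isomorphic to the strong triangle on the same first morphism (`IsApproximation.exists_isIso`), and
  is therefore strong;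
* for the octahedron axiom, an octahedron of `S` at one large index defines the two missing
  morphisms, and it approximates the fourth triangle, which is thus strong (`exists_octahedron`).

For the metric, only closure under extensions needs an argument (`StrongPresentation.preBall₂`): the
connecting morphism `C ⟶ A⟦1⟧` is lifted to sequences of objects of `M i` and their shifts, and the
cones there present `B⟦1⟧`, up to the isomorphism just obtained.
-/

noncomputable section

namespace MetricCompletion

/-! ### Sequential colimits of right modules -/


section SequentialColimits

variable {S : Type u} [Category.{v} S] [Preadditive S]

instance : (yon S).Full := inferInstanceAs (ObjectProperty.lift _ _ _).Full

instance : (yon S).Faithful := inferInstanceAs (ObjectProperty.lift _ _ _).Faithful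

instance : (yon S).Additive where
  map_add {X Y f g} := by
    apply ObjectProperty.hom_ext
    ext Z (h : Z.unop ⟶ X)
    exact Preadditive.comp_add _ _ _ h f g

instance : (additiveFunctor Sᵒᵖ AddCommGrpCat.{v}).IsClosedUnderColimitsOfShape ℕ where
  colimitsOfShape_le := by
    rintro G ⟨p⟩
    refine ⟨fun {X Y f g} => ?_⟩
    have hX := isColimitOfPreserves ((evaluation _ _).obj X) p.isColimit
    refine hX.hom_ext fun j => ?_
    have hj : (p.diag.obj j).Additive := p.prop_diag_obj j
    have nat (k : X ⟶ Y) := (p.ι.app j).naturality k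
    change (p.ι.app j).app X ≫ G.map (f + g) = (p.ι.app j).app X ≫ (G.map f + G.map g)
    rw [Preadditive.comp_add]
    erw [← nat, ← nat, ← nat]
    rw [(p.diag.obj j).map_add, Preadditive.add_comp]

instance : HasColimitsOfShape ℕ (RightMod S) :=
  hasColimitsOfShape_of_closedUnderColimits ℕ _

/-- Evaluation of right modules at an object of `S`. -/
abbrev evalMod (X : S) : RightMod S ⥤ AddCommGrpCat.{v} :=
  (additiveFunctor Sᵒᵖ AddCommGrpCat.{v}).ι ⋙ (evaluation _ _).obj (op X)

instance (X : S) : PreservesColimitsOfShape ℕ (evalMod X) := inferInstance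

lemma yon_hom_ext {X : S} {F : RightMod S} {f g : (yon S).obj X ⟶ F}
    (h : f.hom.app (op X) (𝟙 X) = g.hom.app (op X) (𝟙 X)) : f = g := by
  apply ObjectProperty.hom_ext
  ext Z (k : Z.unop ⟶ X)
  have hf := ConcreteCategory.congr_hom (f.hom.naturality k.op) (𝟙 X)
  have hg := ConcreteCategory.congr_hom (g.hom.naturality k.op) (𝟙 X)
  have hk : ((yon S).obj X).obj.map k.op (𝟙 X) = k := Category.comp_id k
  change f.hom.app Z (((yon S).obj X).obj.map k.op (𝟙 X)) = F.obj.map k.op _ at hf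
  change g.hom.app Z (((yon S).obj X).obj.map k.op (𝟙 X)) = F.obj.map k.op _ at hg
  rw [hk] at hf hg
  exact hf.trans ((congrArg _ h).trans hg.symm)

lemma yon_map_comp_app_id {X Y : S} {F : RightMod S} (g : X ⟶ Y) (f : (yon S).obj Y ⟶ F) :
    ((yon S).map g ≫ f).hom.app (op X) (𝟙 X) = f.hom.app (op X) g :=
  congrArg (f.hom.app (op X)) (Category.id_comp g)

instance : PreservesColimitsOfShape ℕ (forget AddCommGrpCat.{v}) :=
  haveI : PreservesFilteredColimitsOfSize.{0, 0} (forget AddCommGrpCat.{v}) :=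
    preservesSmallestFilteredColimits_of_preservesFilteredColimits _
  inferInstance

variable {E : ℕ ⥤ S} {F : RightMod S} {c : E ⋙ yon S ⟶ (Functor.const ℕ).obj F}

lemma exists_yon_lift (hc : IsColimit (Cocone.mk F c)) {X : S} (f : (yon S).obj X ⟶ F) :
    ∃ (n : ℕ) (g : X ⟶ E.obj n), (yon S).map g ≫ c.app n = f := by
  obtain ⟨n, g, hg⟩ := Concrete.isColimit_exists_rep _
    (isColimitOfPreserves (evalMod X) hc) (f.hom.app (op X) (𝟙 X))
  refine ⟨n, (g : X ⟶ E.obj n), yon_hom_ext ?_⟩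
  refine Eq.trans ?_ hg
  exact yon_map_comp_app_id (X := X) (Y := E.obj n) g (c.app n)

lemma exists_map_eq_of_yon_eq (hc : IsColimit (Cocone.mk F c)) {X : S} {n : ℕ}
    (g g' : X ⟶ E.obj n) (h : (yon S).map g ≫ c.app n = (yon S).map g' ≫ c.app n) :
    ∃ (m : ℕ) (hm : n ≤ m), g ≫ E.map (homOfLE hm) = g' ≫ E.map (homOfLE hm) := by
  obtain ⟨m, a, b, hm⟩ := Concrete.isColimit_exists_of_rep_eq _
    (isColimitOfPreserves (evalMod X) hc) (i := n) (j := n) g g' (by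
      have := congrArg (fun f => f.hom.app (op X) (𝟙 X)) h
      dsimp only at this
      exact (yon_map_comp_app_id g (c.app n)).symm.trans
        (this.trans (yon_map_comp_app_id g' (c.app n))))
  exact ⟨m, leOfHom a, hm⟩

lemma map_comp_cocone (c : E ⋙ yon S ⟶ (Functor.const ℕ).obj F) {n m : ℕ} (h : n ≤ m) :
    (yon S).map (E.map (homOfLE h)) ≫ c.app m = c.app n := by
  have := c.naturality (homOfLE h)
  dsimp at this
  rwa [Category.comp_id] at this

lemma exists_yon_lift_ge (hc : IsColimit (Cocone.mk F c)) {X : S} (f : (yon S).obj X ⟶ F)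
    (N : ℕ) : ∃ n, N ≤ n ∧ ∃ g : X ⟶ E.obj n, (yon S).map g ≫ c.app n = f := by
  obtain ⟨n, g, hg⟩ := exists_yon_lift hc f
  refine ⟨max N n, le_max_left _ _, g ≫ E.map (homOfLE (le_max_right _ _)), ?_⟩
  rw [Functor.map_comp, Category.assoc, map_comp_cocone, hg]

/-- The colimit of a subsequence is the colimit of the sequence. -/
def isColimitSubsequence (hc : IsColimit (Cocone.mk F c)) {φ : ℕ → ℕ} (hφ : Monotone φ)
    (hφ' : ∀ n, n ≤ φ n) :
    IsColimit (Cocone.mk F (F := (hφ.functor ⋙ E) ⋙ yon S)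
      { app := fun n => c.app (φ n)
        naturality := fun _ _ f => c.naturality (hφ.functor.map f) }) :=
  haveI : hφ.functor.Final := (Monotone.final_functor_iff hφ).2 fun n => ⟨n, hφ' n⟩
  (Functor.Final.isColimitWhiskerEquiv hφ.functor (Cocone.mk F c)).symm hc

end SequentialColimits

/-! ### Local right modules -/


section Local

variable {S : Type u} [Category.{v} S] [Preadditive S] [HasZeroObject S] [HasShift S ℤ]
  [∀ n : ℤ, (shiftFunctor S n).Additive] [Pretriangulated S]

/-- A right module `G` is homological if `Hom(Y(-), G)` sends distinguished triangles to exact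
sequences. By rotation it is enough to ask for exactness at the middle term. -/
def IsHomological (G : RightMod S) : Prop :=
  ∀ (T : Triangle S), T ∈ distTriang S → ∀ x : (yon S).obj T.obj₂ ⟶ G,
    (yon S).map T.mor₁ ≫ x = 0 → ∃ y : (yon S).obj T.obj₃ ⟶ G, (yon S).map T.mor₂ ≫ y = x

lemma IsHomological.of_isColimit {E : ℕ ⥤ S} {F : RightMod S}
    {c : E ⋙ yon S ⟶ (Functor.const ℕ).obj F} (hc : IsColimit (Cocone.mk F c)) :
    IsHomological F := by
  intro T hT x hx
  obtain ⟨n, g, rfl⟩ := exists_yon_lift hc x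
  obtain ⟨m, hm, h⟩ := exists_map_eq_of_yon_eq hc (T.mor₁ ≫ g) 0 (by
    rw [Functor.map_comp, Category.assoc, hx, Functor.map_zero, zero_comp])
  rw [zero_comp, Category.assoc] at h
  obtain ⟨k, hk⟩ := Triangle.yoneda_exact₂ T hT _ h
  refine ⟨(yon S).map k ≫ c.app m, ?_⟩
  rw [← Category.assoc, ← Functor.map_comp, ← hk, Functor.map_comp, Category.assoc,
    map_comp_cocone]

variable (M : ℕ → ObjectProperty S)

/-- A right module is local at `i` if it is homological and lies in `Y(M i)^⊥`. -/
structure IsLocalAt (i : ℕ) (G : RightMod S) : Prop where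
  homological : IsHomological G
  eq_zero : ∀ X : S, M i X → ∀ f : (yon S).obj X ⟶ G, f = 0

variable {M}

lemma IsLocalAt.mono [IsGoodMetric M] {i j : ℕ} (h : i ≤ j) {G : RightMod S}
    (hG : IsLocalAt M i G) : IsLocalAt M j G where
  homological := hG.homological
  eq_zero X hX := hG.eq_zero X (by
    induction j, h using Nat.le_induction with
    | base => exact hX
    | succ j _ ih => exact ih (IsGoodMetric.le_prev _ _ hX))

lemma IsHomological.of_completion {G : RightMod S} (hG : completion M G) : IsHomological G := by
  obtain ⟨⟨E, -, c, ⟨hc⟩⟩, -⟩ := hG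
  exact .of_isColimit hc

lemma exists_isLocalAt {G : RightMod S} (hG : completion M G) : ∃ i, IsLocalAt M i G := by
  obtain ⟨i, hi⟩ := hG.2
  exact ⟨i, .of_completion hG, hi⟩

/-- A morphism with cone in `M (i + 1)` is inverted by `Hom(Y(-), G)` for every `G` local at `i`:
both the cone and its negative shift lie in `M i`, where this functor vanishes. -/
lemma IsLocalAt.bijective_map_comp [IsGoodMetric M] {i : ℕ} {G : RightMod S}
    (hG : IsLocalAt M i G) (T : Triangle S) (hT : T ∈ distTriang S) (h : M (i + 1) T.obj₃) :
    Function.Bijective (fun x : (yon S).obj T.obj₂ ⟶ G => (yon S).map T.mor₁ ≫ x) := by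
  constructor
  · intro x x' hx
    dsimp only at hx
    rw [← sub_eq_zero, ← Preadditive.comp_sub] at hx
    obtain ⟨y, hy⟩ := hG.homological T hT _ hx
    rw [hG.eq_zero _ (IsGoodMetric.le_prev _ _ h) y, comp_zero] at hy
    exact (sub_eq_zero.1 hy.symm)
  · intro x
    exact hG.homological T.invRotate (inv_rot_of_distTriang T hT) x (by
      have := hG.eq_zero _ (IsGoodMetric.shift_neg_one _ _ h)
        ((yon S).map T.invRotate.mor₁ ≫ x)
      exact this)

/-- If `F` is the colimit of a Cauchy sequence `E` and `G` is local at `i`, then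
`Hom(F, G) ≅ Hom(Y(E n), G)` for all large `n`. -/
theorem IsCauchy.exists_bijective_comp [IsGoodMetric M] {E : ℕ ⥤ S} (hE : IsCauchy M E)
    {F : RightMod S} {c : E ⋙ yon S ⟶ (Functor.const ℕ).obj F}
    (hc : IsColimit (Cocone.mk F c)) (i : ℕ) :
    ∃ N, ∀ n, N ≤ n → ∀ G : RightMod S, IsLocalAt M i G →
      Function.Bijective (fun f : F ⟶ G => (c.app n : (yon S).obj (E.obj n) ⟶ F) ≫ f) := by
  obtain ⟨N, hN⟩ := hE (i + 1)
  refine ⟨N, fun n hn G hG => ?_⟩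
  have key (m m' : ℕ) (hm : N ≤ m) (h : m ≤ m') : Function.Bijective
      (fun x : (yon S).obj (E.obj m') ⟶ G => (yon S).map (E.map (homOfLE h)) ≫ x) := by
    obtain ⟨D, g, w, hT⟩ := distinguished_cocone_triangle (E.map (homOfLE h))
    exact hG.bijective_map_comp _ hT (hN m m' h hm D g w hT)
  constructor
  · intro f f' hf
    refine hc.hom_ext fun m => ?_
    have h1 : c.app (max n m) ≫ f = c.app (max n m) ≫ f' := by
      apply (key n (max n m) hn (le_max_left _ _)).1
      dsimp only
      rw [← Category.assoc, ← Category.assoc, map_comp_cocone]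
      exact hf
    change c.app m ≫ f = c.app m ≫ f'
    rw [← map_comp_cocone c (le_max_right n m), Category.assoc, Category.assoc, h1]
  · intro x
    choose z hz using fun k : ℕ => (key n (n + k) hn (by lia)).2 x
    dsimp only at hz
    have hz' (k l : ℕ) (h : k ≤ l) :
        (yon S).map (E.map (homOfLE (show n + k ≤ n + l by lia))) ≫ z l = z k := by
      apply (key n (n + k) hn (by lia)).1
      dsimp only
      rw [hz k, ← hz l, ← Category.assoc, ← Functor.map_comp, ← Functor.map_comp, homOfLE_comp]
    -- the term of index `m` maps to `G` through the later term of index `n + m`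
    let d : E ⋙ yon S ⟶ (Functor.const ℕ).obj G :=
      { app := fun m => (yon S).map (E.map (homOfLE (show m ≤ n + m by lia))) ≫ z m
        naturality := fun m m' a => by
          have ha := leOfHom a
          obtain rfl : a = homOfLE ha := Subsingleton.elim _ _
          dsimp
          rw [Category.comp_id, ← hz' m m' ha, ← Category.assoc, ← Category.assoc,
            ← Functor.map_comp, ← Functor.map_comp, ← Functor.map_comp, ← Functor.map_comp,
            homOfLE_comp, homOfLE_comp] }
    refine ⟨hc.desc (Cocone.mk G d), ?_⟩
    refine (hc.fac (Cocone.mk G d) n).trans ?_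
    exact hz n

end Local

/-! ### Cauchy sequences of distinguished triangles -/


section CauchySequences

variable {S : Type u} [Category.{v} S] [Preadditive S] [HasZeroObject S] [HasShift S ℤ]
  [∀ n : ℤ, (shiftFunctor S n).Additive] [Pretriangulated S]

/-- Verdier's `3 × 3` lemma: a commutative square between the first morphisms of two distinguished
triangles extends to a morphism of triangles in such a way that the cones of its components are
part of a distinguished triangle. The third component is obtained from the octahedra on the two
factorizations of the diagonal of the square. -/
lemma exists_completion_with_cones [IsTriangulated S] {T T' : Triangle S}
    (hT : T ∈ distTriang S) (hT' : T' ∈ distTriang S)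
    {a : T.obj₁ ⟶ T'.obj₁} {b : T.obj₂ ⟶ T'.obj₂} (comm : T.mor₁ ≫ b = a ≫ T'.mor₁)
    {Da Db : S} {ga : T'.obj₁ ⟶ Da} {wa : Da ⟶ T.obj₁⟦(1 : ℤ)⟧}
    (ha : Triangle.mk a ga wa ∈ distTriang S)
    {gb : T'.obj₂ ⟶ Db} {wb : Db ⟶ T.obj₂⟦(1 : ℤ)⟧} (hb : Triangle.mk b gb wb ∈ distTriang S) :
    ∃ c : T.obj₃ ⟶ T'.obj₃, T.mor₂ ≫ c = b ≫ T'.mor₂ ∧ T.mor₃ ≫ a⟦(1 : ℤ)⟧' = c ≫ T'.mor₃ ∧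
      ∃ (D : S) (g : T'.obj₃ ⟶ D) (w : D ⟶ T.obj₃⟦(1 : ℤ)⟧), Triangle.mk c g w ∈ distTriang S ∧
        ∃ (p : Db ⟶ D) (q : D ⟶ Da⟦(1 : ℤ)⟧) (r : Da⟦(1 : ℤ)⟧ ⟶ Db⟦(1 : ℤ)⟧),
          Triangle.mk p q r ∈ distTriang S := by
  obtain ⟨Z, v, w, hZ⟩ := distinguished_cocone_triangle (T.mor₁ ≫ b)
  let O := Triangulated.someOctahedron rfl hT hb hZ
  let O' := Triangulated.someOctahedron comm.symm ha hT' hZ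
  obtain ⟨D, g, r, hD⟩ := distinguished_cocone_triangle (O.m₁ ≫ O'.m₃)
  let O'' := Triangulated.someOctahedron rfl O.mem (rot_of_distTriang _ O'.mem) hD
  refine ⟨O.m₁ ≫ O'.m₃, ?_, ?_, D, g, r, hD, O''.m₁, O''.m₃, _, O''.mem⟩
  · have h1 := O.comm₁
    have h2 := O'.comm₃
    rw [← Category.assoc, h1, Category.assoc, h2]
  · have h1 := O.comm₂
    have h2 := O'.comm₄
    rw [Category.assoc, ← h2, ← Category.assoc, h1]

variable {M : ℕ → ObjectProperty S}

/-- A sequence is Cauchy as soon as the cones of its consecutive maps are eventually small: by the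
octahedron axiom the cone of a composite is an extension of the cones of its factors. -/
lemma IsCauchy.of_succ [IsGoodMetric M] [IsTriangulated S] {E : ℕ ⥤ S}
    (h : ∀ i, ∃ N, ∀ n, N ≤ n → ∃ (D : S) (g : E.obj (n + 1) ⟶ D) (w : D ⟶ (E.obj n)⟦(1 : ℤ)⟧),
      Triangle.mk (E.map (homOfLE (n.le_add_right 1))) g w ∈ distTriang S ∧ M i D) :
    IsCauchy M E := by
  intro i
  obtain ⟨N, hN⟩ := h i
  refine ⟨N, fun m m' hm hmN => ?_⟩
  induction m', hm using Nat.le_induction with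
  | base =>
    intro D g w hT
    refine IsGoodMetric.of_isZero ?_
    refine (Triangle.isZero₃_iff_isIso₁ _ hT).2 ?_
    change IsIso (E.map (𝟙 m))
    infer_instance
  | succ k hk ih =>
    intro D g w hT
    obtain ⟨D₁, g₁, w₁, hT₁⟩ := distinguished_cocone_triangle (E.map (homOfLE hk))
    obtain ⟨D₂, g₂, w₂, hT₂, hD₂⟩ := hN k (hmN.trans hk)
    let O := Triangulated.someOctahedron
      (by rw [← Functor.map_comp, homOfLE_comp]) hT₁ hT₂ hT
    exact IsGoodMetric.ext i _ O.mem (ih D₁ g₁ w₁ hT₁) hD₂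

lemma IsCauchy.subsequence {E : ℕ ⥤ S} (hE : IsCauchy M E) {φ : ℕ → ℕ} (hφ : Monotone φ)
    (hφ' : ∀ n, n ≤ φ n) : IsCauchy M (hφ.functor ⋙ E) := by
  intro i
  obtain ⟨N, hN⟩ := hE i
  exact ⟨N, fun m m' h hm D g w hT =>
    hN (φ m) (φ m') (hφ h) (hm.trans (hφ' m)) D g w hT⟩

/-- A morphism of Cauchy sequences is part of a Cauchy sequence of distinguished triangles. -/
theorem exists_cone_sequence [IsGoodMetric M] [IsTriangulated S] {a b : ℕ ⥤ S} (u : a ⟶ b)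
    (ha : IsCauchy M a) (hb : IsCauchy M b) :
    ∃ (c : ℕ ⥤ S) (g : b ⟶ c) (h : c ⟶ a ⋙ shiftFunctor S (1 : ℤ)), IsCauchy M c ∧
      ∀ n, Triangle.mk (u.app n) (g.app n) (h.app n) ∈ distTriang S := by
  choose c g h hT using fun n => distinguished_cocone_triangle (u.app n)
  choose Da ga wa hDa using
    fun n : ℕ => distinguished_cocone_triangle (a.map (homOfLE (n.le_add_right 1)))
  choose Db gb wb hDb using
    fun n : ℕ => distinguished_cocone_triangle (b.map (homOfLE (n.le_add_right 1)))
  choose γ hγ₂ hγ₃ D gD wD hD p q r hpqr using fun n =>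
    exists_completion_with_cones (hT n) (hT (n + 1))
      (u.naturality (homOfLE (n.le_add_right 1))).symm (hDa n) (hDb n)
  refine ⟨Functor.ofSequence γ, NatTrans.ofSequence g fun n => ?_,
    NatTrans.ofSequence h fun n => ?_, IsCauchy.of_succ fun i => ?_, hT⟩
  · rw [Functor.ofSequence_map_homOfLE_succ]
    exact (hγ₂ n).symm
  · rw [Functor.ofSequence_map_homOfLE_succ]
    exact (hγ₃ n).symm
  · obtain ⟨N, hN⟩ := ha (i + 1)
    obtain ⟨N', hN'⟩ := hb i
    refine ⟨max N N', fun n hn => ⟨D n, gD n, wD n, ?_, ?_⟩⟩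
    · rw [Functor.ofSequence_map_homOfLE_succ]
      exact hD n
    · exact IsGoodMetric.ext i _ (hpqr n)
        (hN' n (n + 1) _ ((le_max_right _ _).trans hn) _ _ _ (hDb n))
        (IsGoodMetric.shift_one _ _
          (hN n (n + 1) _ ((le_max_left _ _).trans hn) _ _ _ (hDa n)))

end CauchySequences

section Ladder

variable {S : Type u} [Category.{v} S] [Preadditive S]

/-- A morphism between colimits of sequences is induced by a morphism from the first sequence to a
subsequence of the second. -/
theorem exists_sequence_lift {a b : ℕ ⥤ S} {F G : RightMod S}
    (α : a ⋙ yon S ⟶ (Functor.const ℕ).obj F) {β : b ⋙ yon S ⟶ (Functor.const ℕ).obj G}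
    (hβ : IsColimit (Cocone.mk G β)) (f : F ⟶ G) :
    ∃ (φ : ℕ → ℕ) (hφ : Monotone φ) (u : a ⟶ hφ.functor ⋙ b), (∀ n, n ≤ φ n) ∧
      ∀ n, (yon S).map (u.app n) ≫ β.app (φ n) = α.app n ≫ f := by
  let P (n : ℕ) := { p : Σ k, a.obj n ⟶ b.obj k //
    n ≤ p.1 ∧ (yon S).map p.2 ≫ β.app p.1 = α.app n ≫ f }
  have start : Nonempty (P 0) := by
    obtain ⟨k, g, hg⟩ := exists_yon_lift hβ (α.app 0 ≫ f : (yon S).obj (a.obj 0) ⟶ G)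
    exact ⟨⟨⟨k, g⟩, Nat.zero_le _, hg⟩⟩
  have step (n : ℕ) (p : P n) : ∃ (q : P (n + 1)) (h : p.1.1 ≤ q.1.1),
      a.map (homOfLE (n.le_add_right 1)) ≫ q.1.2 = p.1.2 ≫ b.map (homOfLE h) := by
    obtain ⟨⟨k, g⟩, hk, hg⟩ := p
    obtain ⟨l, hl, g', hg'⟩ := exists_yon_lift_ge hβ
      (α.app (n + 1) ≫ f : (yon S).obj (a.obj (n + 1)) ⟶ G) (max k (n + 1))
    obtain ⟨m, hm, e⟩ := exists_map_eq_of_yon_eq hβ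
      (a.map (homOfLE (n.le_add_right 1)) ≫ g')
      (g ≫ b.map (homOfLE ((le_max_left _ _).trans hl))) (by
        rw [Functor.map_comp, Functor.map_comp, Category.assoc, Category.assoc, hg',
          map_comp_cocone, hg, ← Category.assoc, map_comp_cocone])
    refine ⟨⟨⟨m, g' ≫ b.map (homOfLE hm)⟩, ((le_max_right _ _).trans hl).trans hm, ?_⟩,
      ((le_max_left _ _).trans hl).trans hm, ?_⟩
    · dsimp only
      rw [Functor.map_comp, Category.assoc, map_comp_cocone, hg']
    · dsimp only
      rw [← Category.assoc, e, Category.assoc, ← Functor.map_comp, homOfLE_comp]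
  choose next hle hnext using step
  let s (n : ℕ) : P n := Nat.rec start.some next n
  have hφ : Monotone fun n => (s n).1.1 := monotone_nat_of_le_succ fun n => hle n (s n)
  exact ⟨_, hφ, NatTrans.ofSequence (fun n => (s n).1.2) fun n => hnext n (s n),
    fun n => (s n).2.1, fun n => (s n).2.2⟩

end Ladder

/-! ### Shifts of cocones, and exactness of `Hom(-, G)` on triangles -/


section Shift

variable {S : Type u} [Category.{v} S] [Preadditive S] [HasShift S ℤ]
  [∀ n : ℤ, (shiftFunctor S n).Additive]

/-- The cocone `Y(E n⟦k⟧) ≅ Y(E n)⟦k⟧ ⟶ F⟦k⟧` obtained by shifting a cocone `Y(E n) ⟶ F`. -/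
def shiftCocone {E : ℕ ⥤ S} {F : RightMod S} (c : E ⋙ yon S ⟶ (Functor.const ℕ).obj F) (k : ℤ) :
    (E ⋙ shiftFunctor S k) ⋙ yon S ⟶ (Functor.const ℕ).obj (F⟦k⟧) where
  app n := ((yon S).commShiftIso k).hom.app (E.obj n) ≫ (c.app n)⟦k⟧'
  naturality m n f := by
    have h := ((yon S).commShiftIso k).hom.naturality (E.map f)
    have h' := c.naturality f
    dsimp at h h' ⊢
    rw [Category.comp_id] at h' ⊢
    rw [← Category.assoc, h, Category.assoc, ← Functor.map_comp, h']

/-- Shifting preserves colimits of Yoneda sequences. -/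
def isColimitShiftCocone {E : ℕ ⥤ S} {F : RightMod S} {c : E ⋙ yon S ⟶ (Functor.const ℕ).obj F}
    (hc : IsColimit (Cocone.mk F c)) (k : ℤ) : IsColimit (Cocone.mk (F⟦k⟧) (shiftCocone c k)) :=
  (IsColimit.precomposeHomEquiv (Functor.isoWhiskerLeft E ((yon S).commShiftIso k)) _ |>.symm
    (isColimitOfPreserves (shiftFunctor (RightMod S) k) hc)).ofIsoColimit
      (Cocone.ext (Iso.refl _) fun j => by simp [shiftCocone])

end Shift

section Exactness

variable {S : Type u} [Category.{v} S] [Preadditive S] [HasShift S ℤ]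
  [∀ n : ℤ, (shiftFunctor S n).Additive]

/-- The functor `Hom(-, G)` sends the triangle `A ⟶ B ⟶ C ⟶ A⟦1⟧` to an exact sequence. Only the
part of the long exact sequence needed for a five lemma is recorded. -/
structure IsExactFor {A B C : RightMod S} (f : A ⟶ B) (g : B ⟶ C) (h : C ⟶ A⟦(1 : ℤ)⟧)
    (G : RightMod S) : Prop where
  zero₁₂ (x : C ⟶ G) : f ≫ g ≫ x = 0
  zero₃₁ (x : B⟦(1 : ℤ)⟧ ⟶ G) : h ≫ f⟦(1 : ℤ)⟧' ≫ x = 0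
  exact₂ (x : B ⟶ G) : f ≫ x = 0 → ∃ y : C ⟶ G, g ≫ y = x
  exact₃ (x : C ⟶ G) : g ≫ x = 0 → ∃ y : A⟦(1 : ℤ)⟧ ⟶ G, h ≫ y = x
  exact₁ (x : A⟦(1 : ℤ)⟧ ⟶ G) : h ≫ x = 0 → ∃ y : B⟦(1 : ℤ)⟧ ⟶ G, f⟦(1 : ℤ)⟧' ≫ y = x

/-- Exactness of `Hom(-, G)` passes along a morphism of triangles whose components are inverted by
`Hom(-, G)`. -/
lemma IsExactFor.of_hom {A B C A' B' C' : RightMod S} {f : A ⟶ B} {g : B ⟶ C}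
    {h : C ⟶ A⟦(1 : ℤ)⟧} {f' : A' ⟶ B'} {g' : B' ⟶ C'} {h' : C' ⟶ A'⟦(1 : ℤ)⟧} {G : RightMod S}
    (hV : IsExactFor f g h G) {a : A ⟶ A'} {b : B ⟶ B'} {c : C ⟶ C'} (c₁ : f ≫ b = a ≫ f')
    (c₂ : g ≫ c = b ≫ g') (c₃ : h ≫ a⟦(1 : ℤ)⟧' = c ≫ h')
    (h₁ : Function.Bijective fun x : A' ⟶ G => a ≫ x)
    (h₂ : Function.Bijective fun x : B' ⟶ G => b ≫ x)
    (h₃ : Function.Bijective fun x : C' ⟶ G => c ≫ x)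
    (h₁' : Function.Bijective fun x : A'⟦(1 : ℤ)⟧ ⟶ G => a⟦(1 : ℤ)⟧' ≫ x)
    (h₂' : Function.Bijective fun x : B'⟦(1 : ℤ)⟧ ⟶ G => b⟦(1 : ℤ)⟧' ≫ x) :
    IsExactFor f' g' h' G := by
  have d₁ {Z : RightMod S} (x : B' ⟶ Z) : a ≫ f' ≫ x = f ≫ b ≫ x := by
    rw [← Category.assoc, ← c₁, Category.assoc]
  have d₂ {Z : RightMod S} (x : C' ⟶ Z) : b ≫ g' ≫ x = g ≫ c ≫ x := by
    rw [← Category.assoc, ← c₂, Category.assoc]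
  have d₃ {Z : RightMod S} (x : A'⟦(1 : ℤ)⟧ ⟶ Z) : c ≫ h' ≫ x = h ≫ a⟦(1 : ℤ)⟧' ≫ x := by
    rw [← Category.assoc, ← c₃, Category.assoc]
  have d₁' {Z : RightMod S} (x : B'⟦(1 : ℤ)⟧ ⟶ Z) :
      a⟦(1 : ℤ)⟧' ≫ f'⟦(1 : ℤ)⟧' ≫ x = f⟦(1 : ℤ)⟧' ≫ b⟦(1 : ℤ)⟧' ≫ x := by
    rw [← Category.assoc, ← Functor.map_comp, ← c₁, Functor.map_comp, Category.assoc]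
  refine ⟨fun x => h₁.1 ?_, fun x => h₃.1 ?_, fun x hx => ?_, fun x hx => ?_, fun x hx => ?_⟩
  · dsimp only
    rw [d₁, d₂, hV.zero₁₂, comp_zero]
  · dsimp only
    rw [d₃, d₁', hV.zero₃₁, comp_zero]
  · obtain ⟨y, hy⟩ := hV.exact₂ (b ≫ x) (by rw [← d₁, hx, comp_zero])
    obtain ⟨z, rfl⟩ := h₃.2 y
    exact ⟨z, h₂.1 ((d₂ z).trans hy)⟩
  · obtain ⟨y, hy⟩ := hV.exact₃ (c ≫ x) (by rw [← d₂, hx, comp_zero])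
    obtain ⟨z, rfl⟩ := h₁'.2 y
    exact ⟨z, h₃.1 ((d₃ z).trans hy)⟩
  · obtain ⟨y, hy⟩ := hV.exact₁ (a⟦(1 : ℤ)⟧' ≫ x) (by rw [← d₃, hx, comp_zero])
    obtain ⟨z, rfl⟩ := h₂'.2 y
    exact ⟨z, h₁'.1 ((d₁' z).trans hy)⟩

/-- The five lemma for a morphism of triangles that is the identity on the first two objects, in a
form that only needs `Hom(-, G)` to be exact when `G` is one of the third objects. -/
lemma isIso_of_isExactFor {A B C C' : RightMod S} {f : A ⟶ B} {g : B ⟶ C}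
    {h : C ⟶ A⟦(1 : ℤ)⟧} {g' : B ⟶ C'} {h' : C' ⟶ A⟦(1 : ℤ)⟧}
    (hC : IsExactFor f g h C) (hC' : IsExactFor f g h C')
    (hC₂ : IsExactFor f g' h' C) (hC₂' : IsExactFor f g' h' C')
    (k : C ⟶ C') (hg : g ≫ k = g') (hh : h = k ≫ h') : IsIso k := by
  have inj {G : RightMod S} (h1 : IsExactFor f g h G)
      (h2 : IsExactFor f g' h' G) (x : C' ⟶ G) (hx : k ≫ x = 0) : x = 0 := by
    obtain ⟨y, rfl⟩ := h2.exact₃ x (by rw [← hg, Category.assoc, hx, comp_zero])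
    obtain ⟨z, rfl⟩ := h1.exact₁ y (by rw [hh, Category.assoc, hx])
    exact h2.zero₃₁ z
  obtain ⟨r, hr⟩ := hC₂.exact₂ g (by
    have := hC.zero₁₂ (𝟙 _)
    rwa [Category.comp_id] at this)
  obtain ⟨y, hy⟩ := hC.exact₃ (k ≫ r - 𝟙 C) (by
    rw [Preadditive.comp_sub, ← Category.assoc, hg, hr, Category.comp_id, sub_self])
  have h1 : k ≫ (r - h' ≫ y) = 𝟙 C := by
    rw [Preadditive.comp_sub, ← Category.assoc k h' y, ← hh, hy, sub_sub_cancel]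
  refine ⟨r - h' ≫ y, h1, ?_⟩
  rw [← sub_eq_zero]
  apply inj hC' hC₂'
  rw [Preadditive.comp_sub, ← Category.assoc, h1, Category.id_comp, Category.comp_id, sub_self]

/-- The third morphism of the image under `Y` of a triangle of `S`. -/
abbrev yonMor₃ {A C : S} (h : C ⟶ A⟦(1 : ℤ)⟧) : (yon S).obj C ⟶ ((yon S).obj A)⟦(1 : ℤ)⟧ :=
  (yon S).map h ≫ ((yon S).commShiftIso (1 : ℤ)).hom.app A

lemma yonMor₃_comp_eq_iff {A C : S} (h : C ⟶ A⟦(1 : ℤ)⟧) {G : RightMod S}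
    (y : ((yon S).obj A)⟦(1 : ℤ)⟧ ⟶ G) (x : (yon S).obj C ⟶ G) :
    yonMor₃ h ≫ y = x ↔
      (yon S).map h ≫ (((yon S).commShiftIso (1 : ℤ)).hom.app A ≫ y :
        (yon S).obj (A⟦(1 : ℤ)⟧) ⟶ G) = x :=
  iff_of_eq (congrArg (fun z => z = x) (Category.assoc _ _ _))

lemma yon_map_shift_comp {A B : S} (f : A ⟶ B) {G : RightMod S}
    (y : ((yon S).obj B)⟦(1 : ℤ)⟧ ⟶ G) :
    (yon S).map (f⟦(1 : ℤ)⟧') ≫ (((yon S).commShiftIso (1 : ℤ)).hom.app B ≫ y :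
        (yon S).obj (B⟦(1 : ℤ)⟧) ⟶ G) =
      ((yon S).commShiftIso (1 : ℤ)).hom.app A ≫ ((yon S).map f)⟦(1 : ℤ)⟧' ≫ y := by
  have := (yon S).commShiftIso_hom_naturality f (1 : ℤ)
  exact (Category.assoc _ _ _).symm.trans ((congrArg (fun z => z ≫ y) this).trans
    (Category.assoc _ _ _))

lemma exists_commShiftIso_comp_eq {A : S} {G : RightMod S} (y : (yon S).obj (A⟦(1 : ℤ)⟧) ⟶ G) :
    ∃ z : ((yon S).obj A)⟦(1 : ℤ)⟧ ⟶ G, ((yon S).commShiftIso (1 : ℤ)).hom.app A ≫ z = y :=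
  ⟨((yon S).commShiftIso (1 : ℤ)).inv.app A ≫ y, Iso.hom_inv_id_app_assoc _ _ _⟩

variable [HasZeroObject S] [Pretriangulated S]

lemma IsHomological.isExactFor {G : RightMod S} (hG : IsHomological G) {A B C : S} {f : A ⟶ B}
    {g : B ⟶ C} {h : C ⟶ A⟦(1 : ℤ)⟧} (hT : Triangle.mk f g h ∈ distTriang S) :
    IsExactFor ((yon S).map f) ((yon S).map g) (yonMor₃ h) G where
  zero₁₂ x := by
    have : f ≫ g = 0 := comp_distTriang_mor_zero₁₂ _ hT
    rw [← Category.assoc, ← Functor.map_comp, this, Functor.map_zero, zero_comp]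
  zero₃₁ x := by
    have : h ≫ f⟦(1 : ℤ)⟧' = 0 := comp_distTriang_mor_zero₃₁ _ hT
    rw [yonMor₃_comp_eq_iff, ← yon_map_shift_comp, ← Category.assoc, ← Functor.map_comp, this,
      Functor.map_zero, zero_comp]
  exact₂ x hx := hG _ hT x hx
  exact₃ x hx := by
    obtain ⟨y, hy⟩ := hG _ (rot_of_distTriang _ hT) x hx
    obtain ⟨z, rfl⟩ := exists_commShiftIso_comp_eq (A := A) (G := G) y
    exact ⟨z, (yonMor₃_comp_eq_iff h z x).2 hy⟩
  exact₁ x hx := by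
    obtain ⟨y, hy⟩ := hG _ (rot_of_distTriang _ (rot_of_distTriang _ hT))
      (((yon S).commShiftIso (1 : ℤ)).hom.app A ≫ x) ((yonMor₃_comp_eq_iff h x 0).1 hx)
    change (yon S).map (-f⟦(1 : ℤ)⟧') ≫ y = _ at hy
    obtain ⟨z, rfl⟩ := exists_commShiftIso_comp_eq (A := B) (G := G) y
    refine ⟨-z, ?_⟩
    rw [← cancel_epi (((yon S).commShiftIso (1 : ℤ)).hom.app A), ← yon_map_shift_comp]
    refine Eq.trans ?_ hy
    rw [Functor.map_neg, Preadditive.neg_comp, Preadditive.comp_neg, Preadditive.comp_neg]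

end Exactness

/-! ### Strong triangles and their approximations -/


section StrongTriangles

variable {S : Type u} [Category.{v} S] [Preadditive S] [HasZeroObject S] [HasShift S ℤ]
  [∀ n : ℤ, (shiftFunctor S n).Additive] [Pretriangulated S]

variable (M : ℕ → ObjectProperty S)

/-- A Cauchy sequence `a ⟶ b ⟶ c ⟶ a⟦1⟧` of distinguished triangles of `S` together with cocones
exhibiting `A ⟶ B ⟶ C ⟶ A⟦1⟧` as the colimit of its image under `Y`. -/
structure StrongPresentation {A B C : RightMod S} (f : A ⟶ B) (g : B ⟶ C)
    (h : C ⟶ A⟦(1 : ℤ)⟧) where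
  a : ℕ ⥤ S
  b : ℕ ⥤ S
  c : ℕ ⥤ S
  u : a ⟶ b
  v : b ⟶ c
  w : c ⟶ a ⋙ shiftFunctor S (1 : ℤ)
  dist (n : ℕ) : Triangle.mk (u.app n) (v.app n) (w.app n) ∈ distTriang S
  cauchy₁ : IsCauchy M a
  cauchy₂ : IsCauchy M b
  cauchy₃ : IsCauchy M c
  α : a ⋙ yon S ⟶ (Functor.const ℕ).obj A
  β : b ⋙ yon S ⟶ (Functor.const ℕ).obj B
  γ : c ⋙ yon S ⟶ (Functor.const ℕ).obj C
  isColimit₁ : IsColimit (Cocone.mk A α)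
  isColimit₂ : IsColimit (Cocone.mk B β)
  isColimit₃ : IsColimit (Cocone.mk C γ)
  comm₁ (n : ℕ) : (yon S).map (u.app n) ≫ β.app n = α.app n ≫ f
  comm₂ (n : ℕ) : (yon S).map (v.app n) ≫ γ.app n = β.app n ≫ g
  comm₃ (n : ℕ) : yonMor₃ (w.app n) ≫ (α.app n)⟦(1 : ℤ)⟧' = γ.app n ≫ h

variable {M}

lemma IsStrongTriangle.nonempty_presentation {T : Triangle (RightMod S)}
    (hT : IsStrongTriangle M T) : Nonempty (StrongPresentation M T.mor₁ T.mor₂ T.mor₃) := by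
  obtain ⟨t, ht, h₁, h₂, h₃, c, ⟨hc₁⟩, ⟨hc₂⟩, ⟨hc₃⟩⟩ := hT
  exact ⟨{
    a := t ⋙ Triangle.π₁
    b := t ⋙ Triangle.π₂
    c := t ⋙ Triangle.π₃
    u := Functor.whiskerLeft t Triangle.π₁Toπ₂
    v := Functor.whiskerLeft t Triangle.π₂Toπ₃
    w := Functor.whiskerLeft t Triangle.π₃Toπ₁
    dist := ht
    cauchy₁ := h₁
    cauchy₂ := h₂
    cauchy₃ := h₃
    α := { app n := (c.app n).hom₁
           naturality _ _ k := congrArg TriangleMorphism.hom₁ (c.naturality k) }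
    β := { app n := (c.app n).hom₂
           naturality _ _ k := congrArg TriangleMorphism.hom₂ (c.naturality k) }
    γ := { app n := (c.app n).hom₃
           naturality _ _ k := congrArg TriangleMorphism.hom₃ (c.naturality k) }
    isColimit₁ := hc₁
    isColimit₂ := hc₂
    isColimit₃ := hc₃
    comm₁ n := (c.app n).comm₁
    comm₂ n := (c.app n).comm₂
    comm₃ n := (c.app n).comm₃ }⟩

variable {A B C : RightMod S} {f : A ⟶ B} {g : B ⟶ C} {h : C ⟶ A⟦(1 : ℤ)⟧}

lemma StrongPresentation.isStrongTriangle (P : StrongPresentation M f g h) :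
    IsStrongTriangle M (Triangle.mk f g h) := by
  refine ⟨Triangle.functorMk P.u P.v P.w, P.dist, P.cauchy₁, P.cauchy₂, P.cauchy₃,
    { app n := { hom₁ := P.α.app n
                 hom₂ := P.β.app n
                 hom₃ := P.γ.app n
                 comm₁ := P.comm₁ n
                 comm₂ := P.comm₂ n
                 comm₃ := P.comm₃ n }
      naturality _ _ k := ?_ }, ⟨P.isColimit₁⟩, ⟨P.isColimit₂⟩, ⟨P.isColimit₃⟩⟩
  ext1
  · exact P.α.naturality k
  · exact P.β.naturality k
  · exact P.γ.naturality k

/-- Strong triangles are stable under rotation. -/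
def StrongPresentation.rotate [IsGoodMetric M] (P : StrongPresentation M f g h) :
    StrongPresentation M g h (-f⟦(1 : ℤ)⟧') where
  a := P.b
  b := P.c
  c := P.a ⋙ shiftFunctor S (1 : ℤ)
  u := P.v
  v := P.w
  w := -Functor.whiskerRight P.u (shiftFunctor S (1 : ℤ))
  dist n := rot_of_distTriang _ (P.dist n)
  cauchy₁ := P.cauchy₂
  cauchy₂ := P.cauchy₃
  cauchy₃ := P.cauchy₁.shift 1
  α := P.β
  β := P.γ
  γ := shiftCocone P.α 1
  isColimit₁ := P.isColimit₂
  isColimit₂ := P.isColimit₃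
  isColimit₃ := isColimitShiftCocone P.isColimit₁ 1
  comm₁ := P.comm₂
  comm₂ n := (Category.assoc _ _ _).symm.trans (P.comm₃ n)
  comm₃ n := by
    have h1 := congrArg (fun k => k⟦(1 : ℤ)⟧') (P.comm₁ n)
    rw [Functor.map_comp] at h1
    rw [yonMor₃_comp_eq_iff]
    change (yon S).map (-(P.u.app n)⟦(1 : ℤ)⟧') ≫ _ =
      (((yon S).commShiftIso (1 : ℤ)).hom.app (P.a.obj n) ≫ (P.α.app n)⟦(1 : ℤ)⟧') ≫ _
    rw [Functor.map_neg, Preadditive.neg_comp, yon_map_shift_comp, Preadditive.comp_neg,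
      Category.assoc]
    erw [h1]
    rw [Functor.map_comp]

/-- Strong triangles are stable under isomorphisms of the third object. -/
def StrongPresentation.ofIso (P : StrongPresentation M f g h) {C' : RightMod S} {g' : B ⟶ C'}
    {h' : C' ⟶ A⟦(1 : ℤ)⟧} (k : C ⟶ C') [IsIso k] (hg : g ≫ k = g') (hh : h = k ≫ h') :
    StrongPresentation M f g' h' :=
  { P with
    γ := P.γ ≫ (Functor.const ℕ).map k
    isColimit₃ := P.isColimit₃.ofIsoColimit (Cocone.ext (asIso k) fun _ => rfl)
    comm₂ n := by
      subst hg
      have := P.comm₂ n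
      change (yon S).map (P.v.app n) ≫ P.γ.app n ≫ k = _
      rw [← Category.assoc, ← Category.assoc, this]
    comm₃ n := by
      subst hh
      exact (P.comm₃ n).trans (Category.assoc _ _ _).symm }

end StrongTriangles

section Approximations

variable {S : Type u} [Category.{v} S] [Preadditive S] [HasZeroObject S] [HasShift S ℤ]
  [∀ n : ℤ, (shiftFunctor S n).Additive] [Pretriangulated S]

variable (M : ℕ → ObjectProperty S)

/-- A morphism of right modules that is inverted by `Hom(-, G)` for every `G` local at `i`. -/
def IsLocalEquiv (i : ℕ) {A B : RightMod S} (f : A ⟶ B) : Prop :=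
  ∀ G : RightMod S, IsLocalAt M i G → Function.Bijective fun x : B ⟶ G => f ≫ x

/-- A morphism `(α, β, γ)` from the image under `Y` of a distinguished triangle `(u, v, w)` of `S`
to the triangle `(f, g, h)` whose components and their shifts are inverted by `Hom(-, G)` for every
`G` local at `i`. -/
structure IsApproximation (i : ℕ) {a b c : S} (u : a ⟶ b) (v : b ⟶ c) (w : c ⟶ a⟦(1 : ℤ)⟧)
    {A B C : RightMod S} (f : A ⟶ B) (g : B ⟶ C) (h : C ⟶ A⟦(1 : ℤ)⟧)
    (α : (yon S).obj a ⟶ A) (β : (yon S).obj b ⟶ B) (γ : (yon S).obj c ⟶ C) : Prop where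
  dist : Triangle.mk u v w ∈ distTriang S
  comm₁ : (yon S).map u ≫ β = α ≫ f
  comm₂ : (yon S).map v ≫ γ = β ≫ g
  comm₃ : yonMor₃ w ≫ α⟦(1 : ℤ)⟧' = γ ≫ h
  equiv₁ : IsLocalEquiv M i α
  equiv₂ : IsLocalEquiv M i β
  equiv₃ : IsLocalEquiv M i γ
  shift_equiv₁ : IsLocalEquiv M i (α⟦(1 : ℤ)⟧')
  shift_equiv₂ : IsLocalEquiv M i (β⟦(1 : ℤ)⟧')
  shift_equiv₃ : IsLocalEquiv M i (γ⟦(1 : ℤ)⟧')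

variable {M}

lemma IsCauchy.exists_isLocalEquiv [IsGoodMetric M] {E : ℕ ⥤ S} (hE : IsCauchy M E)
    {F : RightMod S} {c : E ⋙ yon S ⟶ (Functor.const ℕ).obj F}
    (hc : IsColimit (Cocone.mk F c)) (i : ℕ) :
    ∃ N, ∀ n, N ≤ n → IsLocalEquiv M i (c.app n : (yon S).obj (E.obj n) ⟶ F) ∧
      IsLocalEquiv M i ((c.app n : (yon S).obj (E.obj n) ⟶ F)⟦(1 : ℤ)⟧') := by
  obtain ⟨N, hN⟩ := hE.exists_bijective_comp hc i
  obtain ⟨N', hN'⟩ := (hE.shift 1).exists_bijective_comp (isColimitShiftCocone hc 1) i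
  refine ⟨max N N', fun n hn => ⟨hN n ((le_max_left _ _).trans hn), fun G hG => ?_⟩⟩
  have key := hN' n ((le_max_right _ _).trans hn) G hG
  have e (x : F⟦(1 : ℤ)⟧ ⟶ G) : (shiftCocone c 1).app n ≫ x =
      ((yon S).commShiftIso (1 : ℤ)).hom.app (E.obj n) ≫ (c.app n)⟦(1 : ℤ)⟧' ≫ x :=
    Category.assoc _ _ _
  constructor
  · intro x y hxy
    apply key.1
    dsimp only at hxy ⊢
    refine (e x).trans (Eq.trans ?_ (e y).symm)
    exact congrArg (fun z => ((yon S).commShiftIso (1 : ℤ)).hom.app (E.obj n) ≫ z) hxy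
  · intro y
    obtain ⟨x, hx⟩ := key.2 (((yon S).commShiftIso (1 : ℤ)).hom.app (E.obj n) ≫ y)
    exact ⟨x, (cancel_epi (((yon S).commShiftIso (1 : ℤ)).hom.app (E.obj n))).1
      ((e x).symm.trans hx)⟩

variable {A B C : RightMod S} {f : A ⟶ B} {g : B ⟶ C} {h : C ⟶ A⟦(1 : ℤ)⟧}

lemma StrongPresentation.exists_isApproximation [IsGoodMetric M] (P : StrongPresentation M f g h)
    (i : ℕ) : ∃ N, ∀ n, N ≤ n → IsApproximation M i (P.u.app n) (P.v.app n) (P.w.app n) f g h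
      (P.α.app n) (P.β.app n) (P.γ.app n) := by
  obtain ⟨N₁, h₁⟩ := P.cauchy₁.exists_isLocalEquiv P.isColimit₁ i
  obtain ⟨N₂, h₂⟩ := P.cauchy₂.exists_isLocalEquiv P.isColimit₂ i
  obtain ⟨N₃, h₃⟩ := P.cauchy₃.exists_isLocalEquiv P.isColimit₃ i
  refine ⟨max N₁ (max N₂ N₃), fun n hn => ?_⟩
  simp only [max_le_iff] at hn
  exact
    { dist := P.dist n
      comm₁ := P.comm₁ n
      comm₂ := P.comm₂ n
      comm₃ := P.comm₃ n
      equiv₁ := (h₁ n hn.1).1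
      equiv₂ := (h₂ n hn.2.1).1
      equiv₃ := (h₃ n hn.2.2).1
      shift_equiv₁ := (h₁ n hn.1).2
      shift_equiv₂ := (h₂ n hn.2.1).2
      shift_equiv₃ := (h₃ n hn.2.2).2 }

section

variable {i : ℕ} {a b c : S} {u : a ⟶ b} {v : b ⟶ c} {w : c ⟶ a⟦(1 : ℤ)⟧}
  {α : (yon S).obj a ⟶ A} {β : (yon S).obj b ⟶ B} {γ : (yon S).obj c ⟶ C}

lemma IsApproximation.isExactFor (H : IsApproximation M i u v w f g h α β γ) {G : RightMod S}
    (hG : IsLocalAt M i G) : IsExactFor f g h G :=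
  (hG.homological.isExactFor H.dist).of_hom H.comm₁ H.comm₂ H.comm₃ (H.equiv₁ G hG)
    (H.equiv₂ G hG) (H.equiv₃ G hG) (H.shift_equiv₁ G hG) (H.shift_equiv₂ G hG)

/-- A commutative square from an approximated triangle to a strong triangle extends to a morphism
of triangles: the square lifts to a square of `S` on the approximating triangle, where it can be
completed, and the third component extends along the approximation. -/
lemma IsApproximation.exists_hom (H : IsApproximation M i u v w f g h α β γ)
    {A' B' C' : RightMod S} {f' : A' ⟶ B'} {g' : B' ⟶ C'} {h' : C' ⟶ A'⟦(1 : ℤ)⟧}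
    (P : StrongPresentation M f' g' h') (hC' : IsLocalAt M i C')
    (hA' : IsLocalAt M i (A'⟦(1 : ℤ)⟧)) (x : A ⟶ A') (y : B ⟶ B') (e : f ≫ y = x ≫ f') :
    ∃ z : C ⟶ C', g ≫ z = y ≫ g' ∧ h ≫ x⟦(1 : ℤ)⟧' = z ≫ h' := by
  obtain ⟨k, p, hp⟩ := exists_yon_lift P.isColimit₁ (α ≫ x)
  obtain ⟨l, hl, q, hq⟩ := exists_yon_lift_ge P.isColimit₂ (β ≫ y) k
  obtain ⟨m, hm, hpq⟩ := exists_map_eq_of_yon_eq P.isColimit₂ (u ≫ q)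
    (p ≫ P.a.map (homOfLE hl) ≫ P.u.app l) (by
      rw [Functor.map_comp, Functor.map_comp, Functor.map_comp, Category.assoc, Category.assoc,
        Category.assoc, hq, P.comm₁ l, ← Category.assoc ((yon S).map (P.a.map _)),
        map_comp_cocone, ← Category.assoc, ← Category.assoc, H.comm₁, hp, Category.assoc,
        Category.assoc, e])
  have nat := P.u.naturality (homOfLE hm)
  obtain ⟨r, hr₂, hr₃⟩ : ∃ r : c ⟶ P.c.obj m,
      v ≫ r = (q ≫ P.b.map (homOfLE hm)) ≫ P.v.app m ∧
      w ≫ (p ≫ P.a.map (homOfLE (hl.trans hm)))⟦(1 : ℤ)⟧' = r ≫ P.w.app m :=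
    complete_distinguished_triangle_morphism _ _ H.dist (P.dist m)
      (p ≫ P.a.map (homOfLE (hl.trans hm))) (q ≫ P.b.map (homOfLE hm)) (by
        change u ≫ q ≫ _ = (p ≫ _) ≫ P.u.app m
        rw [← Category.assoc, hpq, Category.assoc, Category.assoc, Category.assoc, ← nat,
          ← Category.assoc (P.a.map _), ← Functor.map_comp, homOfLE_comp])
  obtain ⟨z, hz⟩ := (H.equiv₃ C' hC').2 ((yon S).map r ≫ P.γ.app m)
  dsimp only at hz
  refine ⟨z, (H.equiv₂ C' hC').1 ?_, (H.equiv₃ _ hA').1 ?_⟩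
  · dsimp only
    rw [← Category.assoc, ← H.comm₂, Category.assoc, hz, ← Category.assoc, ← Functor.map_comp, hr₂,
      Functor.map_comp, Functor.map_comp, Category.assoc, Category.assoc, P.comm₂ m,
      ← Category.assoc ((yon S).map (P.b.map _)), map_comp_cocone, ← Category.assoc, hq,
      Category.assoc]
  · dsimp only
    have hp' : (yon S).map (p ≫ P.a.map (homOfLE (hl.trans hm))) ≫ P.α.app m = α ≫ x := by
      rw [Functor.map_comp, Category.assoc, map_comp_cocone, hp]
    have e₁ : γ ≫ h ≫ x⟦(1 : ℤ)⟧' = yonMor₃ w ≫ (α ≫ x)⟦(1 : ℤ)⟧' := by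
      rw [← Category.assoc, ← H.comm₃, Functor.map_comp, Category.assoc (yonMor₃ w)]
    have e₂ : γ ≫ z ≫ h' = (yon S).map r ≫ yonMor₃ (P.w.app m) ≫ (P.α.app m)⟦(1 : ℤ)⟧' := by
      rw [← Category.assoc, hz, P.comm₃ m]
      exact Category.assoc _ _ _
    rw [e₁, e₂, ← hp', yonMor₃_comp_eq_iff, Functor.map_comp, ← yon_map_shift_comp,
      ← Category.assoc, ← Functor.map_comp, hr₃, Functor.map_comp, Category.assoc]
    exact congrArg _ (Category.assoc _ _ _).symm

/-- An approximated triangle is isomorphic to any strong triangle with the same first morphism. -/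
lemma IsApproximation.exists_isIso [IsGoodMetric M]
    (H : IsApproximation M i u v w f g h α β γ)
    (hC : IsLocalAt M i C) (hA : IsLocalAt M i (A⟦(1 : ℤ)⟧))
    {C' : RightMod S} {g' : B ⟶ C'} {h' : C' ⟶ A⟦(1 : ℤ)⟧}
    (P : StrongPresentation M f g' h') (hC' : IsLocalAt M i C') :
    ∃ z : C ⟶ C', IsIso z ∧ g ≫ z = g' ∧ h = z ≫ h' := by
  obtain ⟨z, hz₂, hz₃⟩ := H.exists_hom P hC' hA (𝟙 A) (𝟙 B) (by simp)
  obtain ⟨N, hN⟩ := P.exists_isApproximation i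
  have H' := hN N le_rfl
  rw [Category.id_comp] at hz₂
  rw [CategoryTheory.Functor.map_id, Category.comp_id] at hz₃
  exact ⟨z, isIso_of_isExactFor (H.isExactFor hC) (H.isExactFor hC')
    (H'.isExactFor hC) (H'.isExactFor hC') z hz₂ hz₃, hz₂, hz₃⟩

end

end Approximations

/-! ### Cones, rotation and morphisms of strong triangles -/


section Cones

variable {S : Type u} [Category.{v} S] [Preadditive S] [HasZeroObject S] [HasShift S ℤ]
  [∀ n : ℤ, (shiftFunctor S n).Additive] [Pretriangulated S]
  {M : ℕ → ObjectProperty S} [IsGoodMetric M]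

lemma exists_forall_isLocalAt (l : List (RightMod S)) (hl : ∀ F ∈ l, completion M F) :
    ∃ i, ∀ F ∈ l, IsLocalAt M i F := by
  induction l with
  | nil => exact ⟨0, by simp⟩
  | cons F l ih =>
    obtain ⟨i, hi⟩ := ih fun G hG => hl G (List.mem_cons_of_mem _ hG)
    obtain ⟨j, hj⟩ := exists_isLocalAt (hl F List.mem_cons_self)
    refine ⟨max i j, fun G hG => ?_⟩
    rcases List.mem_cons.1 hG with rfl | hG
    · exact hj.mono (le_max_right _ _)
    · exact (hi G hG).mono (le_max_left _ _)

lemma completion_shift {F : RightMod S} (hF : completion M F) (k : ℤ) : completion M (F⟦k⟧) :=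
  (completion M).le_shift k _ hF

variable {A B C : RightMod S} {f : A ⟶ B} {g : B ⟶ C} {h : C ⟶ A⟦(1 : ℤ)⟧}

omit [IsGoodMetric M] in
/-- The third object of a strong triangle is orthogonal to whatever `B` and `A⟦1⟧` are orthogonal
to, since `Hom(Y(X), -)` is exact on strong triangles. -/
lemma StrongPresentation.isLocalAt₃ (P : StrongPresentation M f g h) {i : ℕ}
    (hB : IsLocalAt M i B) (hA : IsLocalAt M i (A⟦(1 : ℤ)⟧)) : IsLocalAt M i C where
  homological := .of_isColimit P.isColimit₃
  eq_zero X hX x := by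
    obtain ⟨n, k, rfl⟩ := exists_yon_lift P.isColimit₃ x
    have h0 : (yon S).map (k ≫ P.w.app n) ≫ (shiftCocone P.α 1).app n = 0 := by
      have := hA.eq_zero X hX (((yon S).map k ≫ P.γ.app n) ≫ h)
      rw [Category.assoc, ← P.comm₃ n] at this
      rw [Functor.map_comp, Category.assoc]
      refine Eq.trans ?_ this
      congr 1
    obtain ⟨m, hm, hk⟩ := exists_map_eq_of_yon_eq (isColimitShiftCocone P.isColimit₁ 1)
      (k ≫ P.w.app n) 0 (by rw [h0, Functor.map_zero, zero_comp])
    rw [zero_comp, Category.assoc, ← P.w.naturality, ← Category.assoc] at hk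
    obtain ⟨l, hl⟩ : ∃ l : X ⟶ P.b.obj m, k ≫ P.c.map (homOfLE hm) = l ≫ P.v.app m :=
      Triangle.coyoneda_exact₃ _ (P.dist m) _ hk
    rw [← map_comp_cocone P.γ hm, ← Category.assoc, ← Functor.map_comp, hl, Functor.map_comp,
      Category.assoc, P.comm₂ m, ← Category.assoc,
      hB.eq_zero X hX ((yon S).map l ≫ P.β.app m), zero_comp]

lemma StrongPresentation.completion₃ (P : StrongPresentation M f g h) (hA : completion M A)
    (hB : completion M B) : completion M C := by
  obtain ⟨i, hi⟩ := exists_forall_isLocalAt [B, A⟦(1 : ℤ)⟧] (M := M)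
    (by simp [hB, completion_shift hA 1])
  exact ⟨⟨P.c, P.cauchy₃, P.γ, ⟨P.isColimit₃⟩⟩, i,
    (P.isLocalAt₃ (hi B (by simp)) (hi _ (by simp))).eq_zero⟩

/-- A morphism between the first two objects of strong triangles of `𝔖(S)` extends to a morphism of
triangles. -/
theorem StrongPresentation.exists_hom (P : StrongPresentation M f g h)
    {A' B' C' : RightMod S} {f' : A' ⟶ B'} {g' : B' ⟶ C'} {h' : C' ⟶ A'⟦(1 : ℤ)⟧}
    (P' : StrongPresentation M f' g' h') (hA' : completion M A') (hC' : completion M C')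
    (x : A ⟶ A') (y : B ⟶ B') (e : f ≫ y = x ≫ f') :
    ∃ z : C ⟶ C', g ≫ z = y ≫ g' ∧ h ≫ x⟦(1 : ℤ)⟧' = z ≫ h' := by
  obtain ⟨i, hi⟩ := exists_forall_isLocalAt [C', A'⟦(1 : ℤ)⟧] (M := M)
    (by simp [hC', completion_shift hA' 1])
  obtain ⟨N, hN⟩ := P.exists_isApproximation i
  exact (hN N le_rfl).exists_hom P' (hi _ (by simp)) (hi _ (by simp)) x y e

variable [IsTriangulated S]

/-- A morphism `u` of Cauchy sequences is part of a Cauchy sequence of distinguished triangles, and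
the colimits `A`, `B` of the first two terms are part of a colimit of its image under `Y`. -/
theorem exists_cone {a b : ℕ ⥤ S} (u : a ⟶ b) (ha : IsCauchy M a) (hb : IsCauchy M b)
    {A B : RightMod S} {α : a ⋙ yon S ⟶ (Functor.const ℕ).obj A}
    {β : b ⋙ yon S ⟶ (Functor.const ℕ).obj B} (hβ : IsColimit (Cocone.mk B β)) :
    ∃ (c : ℕ ⥤ S) (v : b ⟶ c) (w : c ⟶ a ⋙ shiftFunctor S (1 : ℤ)) (C : RightMod S) (g : B ⟶ C)
      (h : C ⟶ A⟦(1 : ℤ)⟧) (γ : c ⋙ yon S ⟶ (Functor.const ℕ).obj C)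
      (_ : Nonempty (IsColimit (Cocone.mk C γ))) (_ : IsCauchy M c)
      (_ : ∀ n, Triangle.mk (u.app n) (v.app n) (w.app n) ∈ distTriang S)
      (_ : ∀ n, (yon S).map (v.app n) ≫ γ.app n = β.app n ≫ g),
      ∀ n, yonMor₃ (w.app n) ≫ (α.app n)⟦(1 : ℤ)⟧' = γ.app n ≫ h := by
  obtain ⟨c, v, w, hc, dist⟩ := exists_cone_sequence u ha hb
  let s₂ : Cocone (b ⋙ yon S) :=
    Cocone.mk _ (Functor.whiskerRight v (yon S) ≫ (colimit.cocone (c ⋙ yon S)).ι)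
  let s₃ : Cocone (c ⋙ yon S) :=
    Cocone.mk _ (Functor.whiskerRight w (yon S) ≫ shiftCocone α 1)
  exact ⟨c, v, w, colimit (c ⋙ yon S), hβ.desc s₂, (colimit.isColimit _).desc s₃,
    (colimit.cocone (c ⋙ yon S)).ι, ⟨colimit.isColimit _⟩, hc, dist,
    fun n => (hβ.fac s₂ n).symm, fun n => (Category.assoc _ _ _).trans
      ((colimit.isColimit (c ⋙ yon S)).fac s₃ n).symm⟩

/-- Every morphism of `𝔖(S)` is part of a strong triangle, whose third object lies in `𝔖(S)`. -/
theorem exists_strongPresentation {A B : RightMod S} (hA : completion M A) (hB : completion M B)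
    (f : A ⟶ B) : ∃ (C : RightMod S) (g : B ⟶ C) (h : C ⟶ A⟦(1 : ℤ)⟧),
      Nonempty (StrongPresentation M f g h) ∧ completion M C := by
  obtain ⟨⟨a, ha, α, ⟨hα⟩⟩, -⟩ := id hA
  obtain ⟨⟨b, hb, β, ⟨hβ⟩⟩, -⟩ := id hB
  obtain ⟨φ, hφ, u, hφ', hu⟩ := exists_sequence_lift α hβ f
  obtain ⟨c, v, w, C, g, h, γ, ⟨hγ⟩, hc, dist, h₂, h₃⟩ := exists_cone u ha
    (hb.subsequence hφ hφ') (α := α) (isColimitSubsequence hβ hφ hφ')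
  let P : StrongPresentation M f g h :=
    ⟨a, _, c, u, v, w, dist, ha, hb.subsequence hφ hφ', hc, α, _, γ, hα,
      isColimitSubsequence hβ hφ hφ', hγ, hu, h₂, h₃⟩
  exact ⟨C, g, h, ⟨P⟩, P.completion₃ hA hB⟩

/-- A triangle of `𝔖(S)` is strong if its rotation is: compare it after three rotations with a
strong triangle on the same first morphism. -/
theorem StrongPresentation.nonempty_of_rotate
    (P : StrongPresentation M g h (-f⟦(1 : ℤ)⟧')) (hA : completion M A) (hB : completion M B)
    (hC : completion M C) : Nonempty (StrongPresentation M f g h) := by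
  obtain ⟨C', g', h', ⟨P'⟩, hC'⟩ := exists_strongPresentation hA hB f
  obtain ⟨i, hi⟩ := exists_forall_isLocalAt
    [C⟦(1 : ℤ)⟧, C'⟦(1 : ℤ)⟧, (A⟦(1 : ℤ)⟧)⟦(1 : ℤ)⟧] (M := M)
    (by simp [completion_shift hC 1, completion_shift hC' 1,
      completion_shift (completion_shift hA 1) 1])
  obtain ⟨N, hN⟩ := P.rotate.rotate.exists_isApproximation i
  obtain ⟨z, hz, hz₂, hz₃⟩ := (hN N le_rfl).exists_isIso (hi _ (by simp)) (hi _ (by simp))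
    P'.rotate.rotate.rotate (hi _ (by simp))
  -- `z : C⟦1⟧ ⟶ C'⟦1⟧` is the shift of an isomorphism `k : C ⟶ C'`
  obtain ⟨k, rfl⟩ := (shiftFunctor (RightMod S) (1 : ℤ)).map_surjective z
  have : IsIso k := isIso_of_reflects_iso k (shiftFunctor (RightMod S) (1 : ℤ))
  have hg : g ≫ k = g' := by
    rw [Preadditive.neg_comp, neg_inj, ← Functor.map_comp] at hz₂
    exact (shiftFunctor (RightMod S) (1 : ℤ)).map_injective hz₂
  have hh : h = k ≫ h' := by
    rw [Preadditive.comp_neg, neg_inj, ← Functor.map_comp] at hz₃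
    exact (shiftFunctor (RightMod S) (1 : ℤ)).map_injective hz₃
  exact ⟨P'.ofIso (inv k) (by rw [← hg, Category.assoc, IsIso.hom_inv_id, Category.comp_id])
    (by rw [hh, IsIso.inv_hom_id_assoc])⟩

end Cones

/-! ### The octahedron axiom for strong triangles -/


section Octahedron

variable {S : Type u} [Category.{v} S] [Preadditive S] [HasZeroObject S] [HasShift S ℤ]
  [∀ n : ℤ, (shiftFunctor S n).Additive] [Pretriangulated S]
  {M : ℕ → ObjectProperty S} [IsGoodMetric M]

omit [HasZeroObject S] [Pretriangulated S] in
lemma yonMor₃_comp_left {A C D : S} (k : D ⟶ C) (h : C ⟶ A⟦(1 : ℤ)⟧) :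
    yonMor₃ (k ≫ h) = (yon S).map k ≫ yonMor₃ h := by
  rw [yonMor₃, Functor.map_comp]
  exact Category.assoc _ _ _

omit [HasZeroObject S] [Pretriangulated S] in
lemma yonMor₃_comp_shift {A B C : S} (h : C ⟶ A⟦(1 : ℤ)⟧) (k : A ⟶ B) :
    yonMor₃ (h ≫ k⟦(1 : ℤ)⟧') = yonMor₃ h ≫ ((yon S).map k)⟦(1 : ℤ)⟧' := by
  rw [yonMor₃, Functor.map_comp]
  have := (yon S).commShiftIso_hom_naturality k (1 : ℤ)
  exact (Category.assoc _ _ _).trans ((congrArg _ this).trans (Category.assoc _ _ _).symm)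

variable [IsTriangulated S]

/-- The octahedron axiom for strong triangles. The octahedra on the terms of sequences inducing `f`
and `g` need not be compatible, but a single one of them, of large index, determines the remaining
two morphisms, and it approximates the triangle that they form. -/
theorem exists_octahedron {A B C : RightMod S} (hA : completion M A) (hB : completion M B)
    (hC : completion M C) (f : A ⟶ B) (g : B ⟶ C) :
    ∃ (D E F : RightMod S) (_ : completion M D) (_ : completion M E) (_ : completion M F)
      (v₁₂ : B ⟶ D) (w₁₂ : D ⟶ A⟦(1 : ℤ)⟧) (v₂₃ : C ⟶ E) (w₂₃ : E ⟶ B⟦(1 : ℤ)⟧)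
      (v₁₃ : C ⟶ F) (w₁₃ : F ⟶ A⟦(1 : ℤ)⟧) (_ : Nonempty (StrongPresentation M f v₁₂ w₁₂))
      (_ : Nonempty (StrongPresentation M g v₂₃ w₂₃))
      (_ : Nonempty (StrongPresentation M (f ≫ g) v₁₃ w₁₃)) (m₁ : D ⟶ F) (m₃ : F ⟶ E),
      v₁₂ ≫ m₁ = g ≫ v₁₃ ∧ m₁ ≫ w₁₃ = w₁₂ ∧ v₁₃ ≫ m₃ = v₂₃ ∧ w₁₃ ≫ f⟦(1 : ℤ)⟧' = m₃ ≫ w₂₃ ∧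
        Nonempty (StrongPresentation M m₁ m₃ (w₂₃ ≫ v₁₂⟦(1 : ℤ)⟧')) := by
  obtain ⟨⟨a, ha, α, ⟨hα⟩⟩, -⟩ := id hA
  obtain ⟨⟨b₀, hb₀, β₀, ⟨hβ₀⟩⟩, -⟩ := id hB
  obtain ⟨⟨c₀, hc₀, χ₀, ⟨hχ₀⟩⟩, -⟩ := id hC
  -- sequences `a ⟶ b ⟶ c` inducing `f` and `g`
  obtain ⟨b, hb, β, hβ, u, hu⟩ : ∃ (b : ℕ ⥤ S) (_ : IsCauchy M b)
      (β : b ⋙ yon S ⟶ (Functor.const ℕ).obj B) (_ : IsColimit (Cocone.mk B β)) (u : a ⟶ b),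
      ∀ n, (yon S).map (u.app n) ≫ β.app n = α.app n ≫ f := by
    obtain ⟨φ, hφ, u, hφ', hu⟩ := exists_sequence_lift α hβ₀ f
    exact ⟨_, hb₀.subsequence hφ hφ', _, isColimitSubsequence hβ₀ hφ hφ', u, hu⟩
  obtain ⟨c, hc, χ, hχ, v, hv⟩ : ∃ (c : ℕ ⥤ S) (_ : IsCauchy M c)
      (χ : c ⋙ yon S ⟶ (Functor.const ℕ).obj C) (_ : IsColimit (Cocone.mk C χ)) (v : b ⟶ c),
      ∀ n, (yon S).map (v.app n) ≫ χ.app n = β.app n ≫ g := by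
    obtain ⟨φ, hφ, u, hφ', hu⟩ := exists_sequence_lift β hχ₀ g
    exact ⟨_, hc₀.subsequence hφ hφ', _, isColimitSubsequence hχ₀ hφ hφ', u, hu⟩
  have huv (n : ℕ) : (yon S).map ((u ≫ v).app n) ≫ χ.app n = α.app n ≫ f ≫ g := by
    rw [NatTrans.comp_app, Functor.map_comp, Category.assoc, hv, ← Category.assoc, hu,
      Category.assoc]
  obtain ⟨d, p₁₂, q₁₂, D, v₁₂, w₁₂, δ, ⟨hδ⟩, hd, dist₁₂, h₁₂, h₁₂'⟩ :=
    exists_cone u ha hb (α := α) hβ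
  obtain ⟨e, p₂₃, q₂₃, E, v₂₃, w₂₃, ε, ⟨hε⟩, he, dist₂₃, h₂₃, h₂₃'⟩ :=
    exists_cone v hb hc (α := β) hχ
  obtain ⟨k, p₁₃, q₁₃, F, v₁₃, w₁₃, κ, ⟨hκ⟩, hk, dist₁₃, h₁₃, h₁₃'⟩ :=
    exists_cone (u ≫ v) ha hc (α := α) hχ
  let P₁₂ : StrongPresentation M f v₁₂ w₁₂ :=
    ⟨a, b, d, u, p₁₂, q₁₂, dist₁₂, ha, hb, hd, α, β, δ, hα, hβ, hδ, hu, h₁₂, h₁₂'⟩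
  let P₂₃ : StrongPresentation M g v₂₃ w₂₃ :=
    ⟨b, c, e, v, p₂₃, q₂₃, dist₂₃, hb, hc, he, β, χ, ε, hβ, hχ, hε, hv, h₂₃, h₂₃'⟩
  let P₁₃ : StrongPresentation M (f ≫ g) v₁₃ w₁₃ :=
    ⟨a, c, k, u ≫ v, p₁₃, q₁₃, dist₁₃, ha, hc, hk, α, χ, κ, hα, hχ, hκ, huv, h₁₃, h₁₃'⟩
  have hD : completion M D := P₁₂.completion₃ hA hB
  have hE : completion M E := P₂₃.completion₃ hB hC
  have hF : completion M F := P₁₃.completion₃ hA hC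
  obtain ⟨i, hi⟩ := exists_forall_isLocalAt
    [E, F, A⟦(1 : ℤ)⟧, B⟦(1 : ℤ)⟧, D⟦(1 : ℤ)⟧] (M := M)
    (by simp [hE, hF, completion_shift hA 1, completion_shift hB 1, completion_shift hD 1])
  simp only [List.forall_mem_cons] at hi
  obtain ⟨iE, iF, iA, iB, iD, -⟩ := hi
  obtain ⟨N₁₂, hN₁₂⟩ := P₁₂.exists_isApproximation i
  obtain ⟨N₂₃, hN₂₃⟩ := P₂₃.exists_isApproximation i
  obtain ⟨N₁₃, hN₁₃⟩ := P₁₃.exists_isApproximation i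
  obtain ⟨n, n₁₂, n₂₃, n₁₃⟩ : ∃ n, N₁₂ ≤ n ∧ N₂₃ ≤ n ∧ N₁₃ ≤ n :=
    ⟨max N₁₂ (max N₂₃ N₁₃), by simp⟩
  have H₁₂ := hN₁₂ n n₁₂
  have H₂₃ := hN₂₃ n n₂₃
  have H₁₃ := hN₁₃ n n₁₃
  let O := Triangulated.someOctahedron (u₁₃ := (u ≫ v).app n) rfl (dist₁₂ n) (dist₂₃ n) (dist₁₃ n)
  obtain ⟨m₁, hm₁⟩ := (H₁₂.equiv₃ F iF).2 ((yon S).map O.m₁ ≫ κ.app n)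
  obtain ⟨m₃, hm₃⟩ := (H₁₃.equiv₃ E iE).2 ((yon S).map O.m₃ ≫ ε.app n)
  change δ.app n ≫ m₁ = _ at hm₁
  change κ.app n ≫ m₃ = _ at hm₃
  have H : IsApproximation M i O.m₁ O.m₃ (q₂₃.app n ≫ (p₁₂.app n)⟦(1 : ℤ)⟧') m₁ m₃
      (w₂₃ ≫ v₁₂⟦(1 : ℤ)⟧') (δ.app n) (κ.app n) (ε.app n) :=
    { dist := O.mem
      comm₁ := hm₁.symm
      comm₂ := hm₃.symm
      comm₃ := by
        rw [yonMor₃_comp_shift, Category.assoc, ← Functor.map_comp, h₁₂, Functor.map_comp,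
          ← Category.assoc, h₂₃', Category.assoc]
      equiv₁ := H₁₂.equiv₃
      equiv₂ := H₁₃.equiv₃
      equiv₃ := H₂₃.equiv₃
      shift_equiv₁ := H₁₂.shift_equiv₃
      shift_equiv₂ := H₁₃.shift_equiv₃
      shift_equiv₃ := H₂₃.shift_equiv₃ }
  refine ⟨D, E, F, hD, hE, hF, v₁₂, w₁₂, v₂₃, w₂₃, v₁₃, w₁₃, ⟨P₁₂⟩, ⟨P₂₃⟩, ⟨P₁₃⟩, m₁, m₃,
    (H₁₂.equiv₂ F iF).1 ?_, (H₁₂.equiv₃ _ iA).1 ?_, (H₁₃.equiv₂ E iE).1 ?_,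
    (H₁₃.equiv₃ _ iB).1 ?_, ?_⟩
  · change β.app n ≫ v₁₂ ≫ m₁ = β.app n ≫ g ≫ v₁₃
    rw [← Category.assoc, ← h₁₂, Category.assoc, hm₁, ← Category.assoc, ← Functor.map_comp,
      O.comm₁, Functor.map_comp, Category.assoc, h₁₃, ← Category.assoc, hv, Category.assoc]
  · change δ.app n ≫ m₁ ≫ w₁₃ = δ.app n ≫ w₁₂
    rw [← Category.assoc, hm₁, Category.assoc, ← h₁₃', ← Category.assoc, ← yonMor₃_comp_left,
      O.comm₂, h₁₂']
  · change χ.app n ≫ v₁₃ ≫ m₃ = χ.app n ≫ v₂₃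
    rw [← Category.assoc, ← h₁₃, Category.assoc, hm₃, ← Category.assoc, ← Functor.map_comp,
      O.comm₃, h₂₃]
  · change κ.app n ≫ w₁₃ ≫ f⟦(1 : ℤ)⟧' = κ.app n ≫ m₃ ≫ w₂₃
    rw [← Category.assoc, ← h₁₃', Category.assoc, ← Functor.map_comp, ← hu, Functor.map_comp,
      ← Category.assoc, ← yonMor₃_comp_shift, O.comm₄, yonMor₃_comp_left, Category.assoc, h₂₃',
      ← Category.assoc, ← hm₃, Category.assoc]
  · obtain ⟨G, g', h', ⟨P⟩, -⟩ := exists_strongPresentation hD hF m₁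
    obtain ⟨z, hz, hz₂, hz₃⟩ := H.exists_isIso iE iD P (P.isLocalAt₃ iF iD)
    exact ⟨P.ofIso (inv z) (by rw [← hz₂, Category.assoc, IsIso.hom_inv_id, Category.comp_id])
      (by rw [hz₃, IsIso.inv_hom_id_assoc])⟩

end Octahedron

/-! ### The triangulated structure on `𝔖(S)` -/


section CompletionTriangles

variable {S : Type u} [Category.{v} S] [Preadditive S] [HasZeroObject S] [HasShift S ℤ]
  [∀ n : ℤ, (shiftFunctor S n).Additive] [Pretriangulated S] {M : ℕ → ObjectProperty S}

lemma IsStrongTriangle.of_iso {T T' : Triangle (RightMod S)} (e : T ≅ T')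
    (hT : IsStrongTriangle M T) : IsStrongTriangle M T' := by
  obtain ⟨t, ht, h₁, h₂, h₃, c, ⟨hc₁⟩, ⟨hc₂⟩, ⟨hc₃⟩⟩ := hT
  exact ⟨t, ht, h₁, h₂, h₃, c ≫ (Functor.const ℕ).map e.hom,
    ⟨hc₁.ofIsoColimit (Cocone.ext (Triangle.π₁.mapIso e) fun _ => rfl)⟩,
    ⟨hc₂.ofIsoColimit (Cocone.ext (Triangle.π₂.mapIso e) fun _ => rfl)⟩,
    ⟨hc₃.ofIsoColimit (Cocone.ext (Triangle.π₃.mapIso e) fun _ => rfl)⟩⟩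

omit [HasZeroObject S] [HasShift S ℤ] [∀ n : ℤ, (shiftFunctor S n).Additive] [Pretriangulated S] in
lemma isZero_yon_obj {Z : S} (hZ : IsZero Z) : IsZero ((yon S).obj Z) :=
  (yon S).map_isZero hZ

omit [HasZeroObject S] [HasShift S ℤ] [∀ n : ℤ, (shiftFunctor S n).Additive] [Pretriangulated S] in
lemma isColimit_const_of_isZero {Z : S} (hZ : IsZero Z) {F : RightMod S} (hF : IsZero F)
    (c : (Functor.const ℕ).obj Z ⋙ yon S ⟶ (Functor.const ℕ).obj F) :
    Nonempty (IsColimit (Cocone.mk F c)) :=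
  ⟨{ desc := fun _ => hF.to_ _
     fac := fun _ _ => (isZero_yon_obj hZ).eq_of_src _ _
     uniq := fun _ _ _ => hF.eq_of_src _ _ }⟩

variable [IsGoodMetric M]

lemma isCauchy_const {Z : S} (hZ : IsZero Z) : IsCauchy M ((Functor.const ℕ).obj Z) :=
  fun _ => ⟨0, fun _ _ _ _ _ _ _ hT =>
    IsGoodMetric.of_isZero (Triangle.isZero₃_of_isZero₁₂ _ hT hZ hZ)⟩

/-- The triangle `A ⟶ A ⟶ 0 ⟶ A⟦1⟧` is strong. -/
lemma nonempty_strongPresentation_id {A Z : RightMod S} (hA : completion M A) (hZ : IsZero Z) :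
    Nonempty (StrongPresentation M (𝟙 A) (0 : A ⟶ Z) 0) := by
  obtain ⟨⟨a, ha, α, ⟨hα⟩⟩, -⟩ := hA
  obtain ⟨Z₀, hZ₀, -⟩ := IsGoodMetric.zero_mem (M := M) 0
  obtain ⟨hc⟩ := isColimit_const_of_isZero hZ₀ hZ 0
  exact ⟨{
    a := a
    b := a
    c := (Functor.const ℕ).obj Z₀
    u := 𝟙 a
    v := 0
    w := 0
    dist := fun n => isomorphic_distinguished _ (contractible_distinguished (a.obj n)) _
      (Triangle.isoMk _ _ (Iso.refl _) (Iso.refl _) (hZ₀.iso (isZero_zero S))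
        rfl
        (zero_comp.trans comp_zero.symm) (zero_comp.trans comp_zero.symm))
    cauchy₁ := ha
    cauchy₂ := ha
    cauchy₃ := isCauchy_const hZ₀
    α := α
    β := α
    γ := 0
    isColimit₁ := hα
    isColimit₂ := hα
    isColimit₃ := hc
    comm₁ := fun n => by
      rw [NatTrans.id_app, CategoryTheory.Functor.map_id]
      exact (Category.id_comp _).trans (Category.comp_id _).symm
    comm₂ := fun n => by simp
    comm₃ := fun n => (isZero_yon_obj hZ₀).eq_of_src _ _ }⟩

variable (M) in
/-- The compatibility of the inclusion of `𝔖(S)` in `Mod-S` with the shift. -/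
def shiftObjIso (X : Completion M) : (X⟦(1 : ℤ)⟧).obj ≅ X.obj⟦(1 : ℤ)⟧ :=
  ((completion M).ι.commShiftIso (1 : ℤ)).app X

lemma shiftObjIso_naturality {X Y : Completion M} (f : X ⟶ Y) :
    (f⟦(1 : ℤ)⟧').hom ≫ (shiftObjIso M Y).hom = (shiftObjIso M X).hom ≫ f.hom⟦(1 : ℤ)⟧' :=
  (completion M).ι.commShiftIso_hom_naturality f (1 : ℤ)

lemma mem_completionDistTriang_iff (T : Triangle (Completion M)) :
    T ∈ completionDistTriang M ↔ Nonempty (StrongPresentation M T.mor₁.hom T.mor₂.hom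
      (T.mor₃.hom ≫ (shiftObjIso M T.obj₁).hom)) :=
  ⟨fun hT => IsStrongTriangle.nonempty_presentation hT, fun ⟨P⟩ => P.isStrongTriangle⟩

/-- The morphism `Z ⟶ X⟦1⟧` of `𝔖(S)` given by a morphism of right modules. -/
def homToShift {X Z : Completion M} (h : Z.obj ⟶ X.obj⟦(1 : ℤ)⟧) : Z ⟶ X⟦(1 : ℤ)⟧ :=
  ObjectProperty.homMk (h ≫ (shiftObjIso M X).inv)

lemma homToShift_hom_comp {X Z : Completion M} (h : Z.obj ⟶ X.obj⟦(1 : ℤ)⟧) :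
    (homToShift h).hom ≫ (shiftObjIso M X).hom = h := by
  simp [homToShift]

lemma mk_mem_completionDistTriang {X Y Z : Completion M} {f : X ⟶ Y} {g : Y ⟶ Z}
    {h : Z ⟶ X⟦(1 : ℤ)⟧} {h' : Z.obj ⟶ X.obj⟦(1 : ℤ)⟧}
    (H : Nonempty (StrongPresentation M f.hom g.hom h'))
    (e : h.hom ≫ (shiftObjIso M X).hom = h') : Triangle.mk f g h ∈ completionDistTriang M := by
  subst e
  exact (mem_completionDistTriang_iff _).2 H

lemma completionDistTriang_of_iso {T₁ T₂ : Triangle (Completion M)} (e : T₁ ≅ T₂)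
    (hT₁ : T₁ ∈ completionDistTriang M) : T₂ ∈ completionDistTriang M :=
  IsStrongTriangle.of_iso ((completion M).ι.mapTriangle.mapIso e) hT₁

open ZeroObject in
lemma contractibleTriangle_mem_completionDistTriang (X : Completion M) :
    contractibleTriangle X ∈ completionDistTriang M := by
  have hZ : IsZero (0 : Completion M).obj :=
    (completion M).ι.map_isZero (isZero_zero (Completion M))
  exact mk_mem_completionDistTriang (h := 0) (nonempty_strongPresentation_id X.property hZ)
    zero_comp

lemma rotate_mem_completionDistTriang {T : Triangle (Completion M)}
    (hT : T ∈ completionDistTriang M) : T.rotate ∈ completionDistTriang M := by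
  obtain ⟨P⟩ := IsStrongTriangle.nonempty_presentation hT
  exact P.rotate.isStrongTriangle.of_iso ((completion M).ι.mapTriangleRotateIso.app T)

variable [IsTriangulated S]

lemma mem_completionDistTriang_of_rotate {T : Triangle (Completion M)}
    (hT : T.rotate ∈ completionDistTriang M) : T ∈ completionDistTriang M := by
  have h := IsStrongTriangle.of_iso ((completion M).ι.mapTriangleRotateIso.app T).symm hT
  obtain ⟨P⟩ := h.nonempty_presentation
  obtain ⟨Q⟩ := StrongPresentation.nonempty_of_rotate P T.obj₁.property T.obj₂.property
    T.obj₃.property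
  exact Q.isStrongTriangle

lemma exists_mem_completionDistTriang {X Y : Completion M} (f : X ⟶ Y) :
    ∃ (Z : Completion M) (g : Y ⟶ Z) (h : Z ⟶ X⟦(1 : ℤ)⟧),
      Triangle.mk f g h ∈ completionDistTriang M := by
  obtain ⟨C, g, h, P, hC⟩ := exists_strongPresentation X.property Y.property f.hom
  let Z : Completion M := ⟨C, hC⟩
  let h' : Z.obj ⟶ X.obj⟦(1 : ℤ)⟧ := h
  let g' : Y ⟶ Z := ObjectProperty.homMk g
  exact ⟨Z, g', homToShift h', mk_mem_completionDistTriang (h' := h') P (homToShift_hom_comp h')⟩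

variable (M) in
/-- The pretriangulated structure on `𝔖(S)` whose distinguished triangles are the strong
triangles. -/
@[reducible]
def completionPretriangulated : Pretriangulated (Completion M) where
  distinguishedTriangles := completionDistTriang M
  isomorphic_distinguished T₁ hT₁ T₂ e := completionDistTriang_of_iso e.symm hT₁
  contractible_distinguished := contractibleTriangle_mem_completionDistTriang
  distinguished_cocone_triangle := exists_mem_completionDistTriang
  rotate_distinguished_triangle T :=
    ⟨rotate_mem_completionDistTriang, mem_completionDistTriang_of_rotate⟩
  complete_distinguished_triangle_morphism T₁ T₂ h₁ h₂ a b comm := by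
    obtain ⟨P₁⟩ := (mem_completionDistTriang_iff _).1 h₁
    obtain ⟨P₂⟩ := (mem_completionDistTriang_iff _).1 h₂
    obtain ⟨z, hz₂, hz₃⟩ := P₁.exists_hom P₂ T₂.obj₁.property T₂.obj₃.property a.hom b.hom
      (congrArg InducedCategory.Hom.hom comm)
    refine ⟨ObjectProperty.homMk z, ObjectProperty.hom_ext _ hz₂, ObjectProperty.hom_ext _ ?_⟩
    rw [← cancel_mono (shiftObjIso M T₂.obj₁).hom]
    change (T₁.mor₃.hom ≫ (a⟦(1 : ℤ)⟧').hom) ≫ _ = (z ≫ T₂.mor₃.hom) ≫ _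
    rw [Category.assoc, Category.assoc, shiftObjIso_naturality, ← hz₃, Category.assoc]

theorem completion_isTriangulated :
    @IsTriangulated (Completion M) _ _ _ _ _ (completionPretriangulated M) := by
  let _ := completionPretriangulated M
  refine IsTriangulated.mk' fun X Y Z f g => ?_
  obtain ⟨D, E, F, hD, hE, hF, v₁₂, w₁₂, v₂₃, w₂₃, v₁₃, w₁₃, P₁₂, P₂₃, P₁₃, m₁, m₃, c₁, c₂, c₃, c₄,
    P⟩ := exists_octahedron X.property Y.property Z.property f.hom g.hom
  obtain ⟨D, rfl⟩ : ∃ D' : Completion M, D'.obj = D := ⟨⟨D, hD⟩, rfl⟩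
  obtain ⟨E, rfl⟩ : ∃ E' : Completion M, E'.obj = E := ⟨⟨E, hE⟩, rfl⟩
  obtain ⟨F, rfl⟩ : ∃ F' : Completion M, F'.obj = F := ⟨⟨F, hF⟩, rfl⟩
  refine ⟨X, Y, Z, D, E, F, f, g, Iso.refl _, Iso.refl _, Iso.refl _, by simp,
    by simp, ObjectProperty.homMk v₁₂, homToShift w₁₂,
    mk_mem_completionDistTriang P₁₂ (homToShift_hom_comp _), ObjectProperty.homMk v₂₃,
    homToShift w₂₃, mk_mem_completionDistTriang P₂₃ (homToShift_hom_comp _),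
    ObjectProperty.homMk v₁₃, homToShift w₁₃,
    mk_mem_completionDistTriang P₁₃ (homToShift_hom_comp _), ⟨?_⟩⟩
  exact
    { m₁ := ObjectProperty.homMk m₁
      m₃ := ObjectProperty.homMk m₃
      comm₁ := ObjectProperty.hom_ext _ c₁
      comm₂ := by
        apply ObjectProperty.hom_ext
        change m₁ ≫ w₁₃ ≫ (shiftObjIso M X).inv = w₁₂ ≫ (shiftObjIso M X).inv
        rw [← Category.assoc, c₂]
      comm₃ := ObjectProperty.hom_ext _ c₃
      comm₄ := by
        apply ObjectProperty.hom_ext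
        rw [← cancel_mono (shiftObjIso M Y).hom]
        change ((homToShift w₁₃).hom ≫ (f⟦(1 : ℤ)⟧').hom) ≫ _ = (m₃ ≫ (homToShift w₂₃).hom) ≫ _
        rw [Category.assoc, Category.assoc, shiftObjIso_naturality, ← Category.assoc,
          homToShift_hom_comp, homToShift_hom_comp, c₄]
      mem := by
        refine mk_mem_completionDistTriang P ?_
        change ((homToShift w₂₃).hom ≫ ((ObjectProperty.homMk v₁₂ : Y ⟶ D)⟦(1 : ℤ)⟧').hom) ≫ _ = _
        rw [Category.assoc, shiftObjIso_naturality, ← Category.assoc, homToShift_hom_comp]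
        rfl }

end CompletionTriangles

/-! ### The good metric on `𝔖(S)` -/


section Ball

variable {S : Type u} [Category.{v} S] [Preadditive S] [HasZeroObject S] [HasShift S ℤ]
  [∀ n : ℤ, (shiftFunctor S n).Additive] [Pretriangulated S] {M : ℕ → ObjectProperty S}

lemma preBall_of_iso {i : ℕ} {F G : RightMod S} (e : F ≅ G) (hF : preBall M i F) :
    preBall M i G := by
  obtain ⟨E, hE, hi, c, ⟨hc⟩⟩ := hF
  exact ⟨E, hE, hi, c ≫ (Functor.const ℕ).map e.hom,
    ⟨hc.ofIsoColimit (Cocone.ext e fun _ => rfl)⟩⟩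

variable [IsGoodMetric M]

lemma preBall_shift {i j : ℕ} {k : ℤ} (h : ∀ X, M j X → M i (X⟦k⟧)) {F : RightMod S}
    (hF : preBall M j F) : preBall M i (F⟦k⟧) := by
  obtain ⟨E, hE, hj, c, ⟨hc⟩⟩ := hF
  exact ⟨_, hE.shift k, fun n => h _ (hj n), shiftCocone c k, ⟨isColimitShiftCocone hc k⟩⟩

lemma preBall_of_isZero (i : ℕ) {F : RightMod S} (hF : IsZero F) : preBall M i F := by
  obtain ⟨Z, hZ, hi⟩ := IsGoodMetric.zero_mem (M := M) i
  exact ⟨(Functor.const ℕ).obj Z, isCauchy_const hZ, fun _ => hi, 0,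
    isColimit_const_of_isZero hZ hF 0⟩

/-- The class `L i` is closed under extensions in `𝔖(S)`. The connecting morphism `C ⟶ A⟦1⟧` lifts
to a morphism `u` from a sequence in `M i` to the shift of one, so `B⟦1⟧` is the colimit of a
Cauchy sequence of cones of `u`, and these lie in `(M i)⟦1⟧` since `M i` is closed under
extensions. -/
theorem StrongPresentation.preBall₂ [IsTriangulated S] {A B C : RightMod S} {f : A ⟶ B}
    {g : B ⟶ C} {h : C ⟶ A⟦(1 : ℤ)⟧} (P : StrongPresentation M f g h) (hA : completion M A)
    (hB : completion M B) (hC : completion M C) {i : ℕ} (hA' : preBall M i A)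
    (hC' : preBall M i C) : preBall M i B := by
  obtain ⟨a, ha, hai, α, ⟨hα⟩⟩ := hA'
  obtain ⟨c, hc, hci, γ, ⟨hγ⟩⟩ := hC'
  obtain ⟨φ, hφ, u, hφ', hu⟩ := exists_sequence_lift γ (isColimitShiftCocone hα 1) h
  have hβ := isColimitSubsequence (isColimitShiftCocone hα 1) hφ hφ'
  have hb := (ha.shift 1).subsequence hφ hφ'
  obtain ⟨d, v, w, D, g', h', δ, ⟨hδ⟩, hd, dist, h₂, h₃⟩ := exists_cone u hc hb (α := γ) hβ
  let Q : StrongPresentation M h g' h' :=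
    ⟨c, _, d, u, v, w, dist, hc, hb, hd, γ, _, δ, hγ, hβ, hδ, hu, h₂, h₃⟩
  have hD : completion M D := Q.completion₃ hC (completion_shift hA 1)
  obtain ⟨j, hj⟩ := exists_forall_isLocalAt [B⟦(1 : ℤ)⟧, C⟦(1 : ℤ)⟧, D] (M := M)
    (by simp [completion_shift hB 1, completion_shift hC 1, hD])
  obtain ⟨N, hN⟩ := P.rotate.rotate.exists_isApproximation j
  obtain ⟨z, hz, -⟩ := (hN N le_rfl).exists_isIso (hj _ (by simp)) (hj _ (by simp)) Q
    (hj _ (by simp))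
  refine preBall_of_iso (((shiftFunctor (RightMod S) (-1 : ℤ)).mapIso (asIso z)).symm ≪≫
    (shiftFunctorCompIsoId (RightMod S) (1 : ℤ) (-1) (by lia)).app B)
    ⟨_, hd.shift (-1), fun n => ?_, shiftCocone δ (-1), ⟨isColimitShiftCocone hδ (-1)⟩⟩
  exact IsGoodMetric.ext i _ (inv_rot_of_distTriang _ (inv_rot_of_distTriang _ (dist n)))
    (IsGoodMetric.of_iso
      ((shiftFunctorCompIsoId S (1 : ℤ) (-1) (by lia)).symm.app (a.obj (φ n))) (hai _)) (hci n)

lemma ball_shift {i j : ℕ} {k : ℤ} (h : ∀ X, M j X → M i (X⟦k⟧)) {F : Completion M}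
    (hF : ball M j F) : ball M i (F⟦k⟧) :=
  preBall_of_iso (((completion M).ι.commShiftIso k).symm.app F) (preBall_shift h hF)

theorem isGoodMetric_ball [IsTriangulated S] :
    @IsGoodMetric (Completion M) _ _ _ _ _ (completionPretriangulated M) (ball M) := by
  let _ := completionPretriangulated M
  exact
    { zero_mem := fun i =>
        have hZ := isZero_zero (Completion M)
        ⟨_, hZ, preBall_of_isZero i ((completion M).ι.map_isZero hZ)⟩
      shift_neg_one := fun i X hX => ball_shift (IsGoodMetric.shift_neg_one i) hX
      le_prev := fun i X ⟨E, hE, hi, hX⟩ =>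
        ⟨E, hE, fun n => IsGoodMetric.le_prev i _ (hi n), hX⟩
      shift_one := fun i X hX => ball_shift (IsGoodMetric.shift_one i) hX
      ext := fun i T hT h₁ h₃ => by
        obtain ⟨P⟩ := (mem_completionDistTriang_iff T).1 hT
        exact P.preBall₂ T.obj₁.property T.obj₂.property T.obj₃.property h₁ h₃ }

end Ball

end MetricCompletion

end

/-- For a good metric `M` on a triangulated category `S`, the category `𝔖(S)`, with its shift and
with the strong triangles as distinguished triangles, is a triangulated category, and the
subcategories `N i = 𝔖(S) ∩ L i` form a good metric on it. -/
theorem lemma1 {S : Type u} [Category.{v} S] [Preadditive S] [HasZeroObject S] [HasShift S ℤ]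
    [∀ n : ℤ, (shiftFunctor S n).Additive] [Pretriangulated S] [IsTriangulated S]
    (M : ℕ → ObjectProperty S) [MetricCompletion.IsGoodMetric M] :
    ∃ T : Pretriangulated (MetricCompletion.Completion M),
      T.distinguishedTriangles = MetricCompletion.completionDistTriang M ∧
      IsTriangulated (MetricCompletion.Completion M) ∧
      MetricCompletion.IsGoodMetric (MetricCompletion.ball M) := by
  exact ⟨MetricCompletion.completionPretriangulated M, rfl,
    MetricCompletion.completion_isTriangulated, MetricCompletion.isGoodMetric_ball⟩
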